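/- Fix $\sigma>0$ and an integer $k_*\ge 0$. For each $p$ let $X\in\mathbb R^{n\times p}$ ($n=n_p$) satisfy $X^\top X=I_p$, let $\beta^*\in\mathbb R^p$ have support $M^*=\{j:\beta^*_j\ne 0\}$, with $|M^*|=k_*$ for all large $p$, and let $y=X\beta^*+\varepsilon$ with $\varepsilon_1,\dots,\varepsilon_n$ independent $N(0,\sigma^2)$; $X$, $n$, $\beta^*$ and $M^*$ may vary with $p$. Put $U_j=X_j^\top y$, where $X_j$ is the $j$-th column of $X$. For $\lambda\ge 0$ let $\hat\beta(\lambda)$ minimize $\frac12\|y-X\beta\|_2^2+\lambda\|\beta\|_1$ over $\beta\in\mathbb R^p$, let $\lambda_1>\lambda_2>\cdots$ be the knots of the Lasso path, i.e. the values $\lambda>0$ at which the active set $\{j:\hat\beta_j(\lambda)\ne 0\}$ changes (with $\lambda_k=0$ if there are fewer than $k$ knots), let $M_{k-1}$ be the active set just before $\lambda_k$ (as $\lambda$ decreases to $\lambda_k$), and for a set $M$ of column indices let $\tilde\beta_M(\lambda)$ minimize $\frac12\|y-X_M\tilde\beta\|_2^2+\lambda\|\tilde\beta\|_1$ over $\tilde\beta\in\mathbb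 R^{M}$, where $X_M$ consists of the columns of $X$ with index in $M$. The Lasso significance-test statistics are $$T_k=\frac{\langle y,X\hat\beta(\lambda_{k+1})\rangle-\langle y,X_{M_{k-1}}\tilde\beta_{M_{k-1}}(\lambda_{k+1})\rangle}{\sigma^2}.$$ Assume $\min_{j\in M^*}|\beta^*_j|-\sigma\sqrt{2\log p}\to\infty$ as $p\to\infty$. (A minimum over the empty set is $+\infty$, a maximum over the empty set is $-\infty$.) Then, as $p\to\infty$: (1) $\mathbb P\left(\min_{j\in M^*}|U_j|>\max_{j\notin M^*}|U_j|\right)\to 1$. (2) For every fixed $r$, the random vector $(T_{k_*+1},\dots,T_{k_*+r})$ converges in distribution to $(Z_1,\dots,Z_r)$, where $Z_1,\dots,Z_r$ are independent and $Z_i$ is exponentially distributed with mean $1/i$. -/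

import Mathlib

open MeasureTheory ProbabilityTheory Filter Topology Matrix

noncomputable section

namespace LassoTest

/-- The Lasso objective `(1/2) ‖y - X b‖₂² + lam ‖b‖₁`. -/
def lassoObjective {n : ℕ} {ι : Type*} [Fintype ι] (X : Matrix (Fin n) ι ℝ) (y : Fin n → ℝ)
    (lam : ℝ) (b : ι → ℝ) : ℝ :=
  1 / 2 * ∑ i, (y i - (X *ᵥ b) i) ^ 2 + lam * ∑ j, |b j|

open Classical in
/-- A Lasso solution at penalty `lam`: a minimizer of the Lasso objective over all coefficient
vectors (one exists for `lam ≥ 0`; it is unique when the columns of `X` are linearly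
independent). -/
def lassoSol {n : ℕ} {ι : Type*} [Fintype ι] (X : Matrix (Fin n) ι ℝ) (y : Fin n → ℝ)
    (lam : ℝ) : ι → ℝ :=
  if h : ∃ b : ι → ℝ, IsMinOn (lassoObjective X y lam) Set.univ b then h.choose else 0

/-- The support of a coefficient vector, as a finite set of indices. -/
def support {ι : Type*} [Fintype ι] (b : ι → ℝ) : Finset ι :=
  open Classical in Finset.univ.filter fun j => b j ≠ 0

/-- The knots of the Lasso path: the penalties `lam > 0` at which the active set
(the support of the solution) changes. -/
def knotSet {n p : ℕ} (X : Matrix (Fin n) (Fin p) ℝ) (y : Fin n → ℝ) : Set ℝ :=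
  {lam | 0 < lam ∧
    ¬ ∀ᶠ mu in 𝓝 lam, support (lassoSol X y mu) = support (lassoSol X y lam)}

/-- `knot X y k` is the `k`-th largest knot `λ_k` of the Lasso path, `k = 1, 2, …`
(it is `0` if there are fewer than `k` knots; the value at `k = 0` is not used). -/
def knot {n p : ℕ} (X : Matrix (Fin n) (Fin p) ℝ) (y : Fin n → ℝ) : ℕ → ℝ
  | 0 => 0
  | 1 => sSup (knotSet X y)
  | k + 2 => sSup {lam | lam ∈ knotSet X y ∧ lam < knot X y (k + 1)}

/-- The active set `M_{k-1}` of the Lasso path just before `λ_k`, i.e. for penalties slightly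
larger than `λ_k` (the penalty decreases along the path). -/
def activeBefore {n p : ℕ} (X : Matrix (Fin n) (Fin p) ℝ) (y : Fin n → ℝ) (k : ℕ) :
    Finset (Fin p) :=
  open Classical in
    Finset.univ.filter fun j => ∀ᶠ lam in 𝓝[>] (knot X y k), lassoSol X y lam j ≠ 0

/-- The submatrix `X_M` of the columns of `X` with index in `M`. -/
def colSubmatrix {n p : ℕ} (X : Matrix (Fin n) (Fin p) ℝ) (M : Finset (Fin p)) :
    Matrix (Fin n) M ℝ :=
  X.submatrix id (fun j => (j : Fin p))

/-- The statistic
`T_k = (⟨y, X β̂(λ_{k+1})⟩ - ⟨y, X_M β̃_M(λ_{k+1})⟩) / σ²`, with `M = M_{k-1}` the active set just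
before `λ_k`, `β̂` the Lasso solution with design `X` and `β̃_M` the one with design `X_M`. -/
def testStat {n p : ℕ} (X : Matrix (Fin n) (Fin p) ℝ) (σ : ℝ) (y : Fin n → ℝ) (k : ℕ) : ℝ :=
  (y ⬝ᵥ (X *ᵥ lassoSol X y (knot X y (k + 1)))
    - y ⬝ᵥ (colSubmatrix X (activeBefore X y k) *ᵥ
        lassoSol (colSubmatrix X (activeBefore X y k)) y (knot X y (k + 1)))) / σ ^ 2

/-- The Gaussian linear model: the errors `y_i - (X β)_i` are independent and `N(0, σ²)`. -/
structure IsGaussianLinearModel {n p : ℕ} {Ω : Type*} [MeasurableSpace Ω] (P : Measure Ω)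
    (X : Matrix (Fin n) (Fin p) ℝ) (β : Fin p → ℝ) (σ : ℝ) (y : Ω → Fin n → ℝ) : Prop where
  indep : iIndepFun (fun i ω => y ω i - (X *ᵥ β) i) P
  law : ∀ i, HasLaw (fun ω => y ω i - (X *ᵥ β) i) (gaussianReal 0 (σ ^ 2).toNNReal) P

/-- The joint law of `r` independent exponential variables with means `1, 1/2, …, 1/r`
(`expMeasure` is parametrized by the rate, the inverse of the mean). -/
def expLaw (r : ℕ) : Measure (Fin r → ℝ) :=
  Measure.pi fun i : Fin r => expMeasure ((i : ℝ) + 1)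

instance instIsProbabilityMeasureExpLaw (r : ℕ) : IsProbabilityMeasure (expLaw r) := by
  have h : ∀ i : Fin r, IsProbabilityMeasure (expMeasure ((i : ℝ) + 1)) := fun i =>
    isProbabilityMeasure_expMeasure (by positivity)
  unfold expLaw
  infer_instance

end LassoTest

end

noncomputable section

namespace LassoTest

/-! ### The Lasso path for orthonormal designs -/

/-! Orthonormality splits the Lasso problem into one scalar problem per column, solved by
soft-thresholding `U_j`. The knots are therefore the values `|U_j|` in decreasing order, and almost
surely, when these are positive and distinct, `T_k = λ_k (λ_k - λ_{k+1}) / σ²` (`testStat_succ_eq`).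
In the Gaussian model `U_j = β_j + σ Z_j` with independent standard normal `Z_j`.

Separation: `ℙ(|Z| > t) ≤ exp (-t²/2)`, so a union bound makes it unlikely that some null `|Z_j|`
exceeds `√(2 log p) + a`, or that one of the `k_*` signals moves by more than `σ a`, once `a` is
large. The beta-min condition leaves room for every fixed `a`, which gives (1). On this event
`T_{k_*+1}, T_{k_*+2}, …` depend only on the order statistics of the null `|Z_j|`.

Limit law: let `H(t) = -log ℙ(|Z| > t)` be the cumulative hazard. The variables `H(|Z_j|)` are
independent unit exponentials, so by Rényi's representation (`map_spacing_unitExpLaw`) their top `r`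
spacings have exactly the target law as soon as there are at least `r` null variables. Since `H'(t)`
behaves like `t`, a product `a (a - b)` of adjacent order statistics differs from `D = H(a) - H(b)`
by at most `(D² + D) / b²` (`abs_mul_sub_sub_cumHazard_le`). A null order statistic of fixed rank
tends to infinity in probability while `D` stays tight, so the error vanishes and a Slutsky argument
(`tendstoInDistribution_of_hasLaw`) gives (2). -/

/-- The soft-thresholding operator. -/
def softThreshold (lam u : ℝ) : ℝ :=
  if u < -lam then u + lam else if lam < u then u - lam else 0

lemma softThreshold_eq_zero_iff {lam u : ℝ} (hlam : 0 ≤ lam) :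
    softThreshold lam u = 0 ↔ |u| ≤ lam := by
  unfold softThreshold
  rw [abs_le]
  split_ifs with h1 h2 <;> constructor <;> intro h <;> first | constructor | skip
  all_goals try linarith [h.1, h.2]
  all_goals linarith

lemma mul_softThreshold {lam u : ℝ} (hlam : 0 ≤ lam) :
    u * softThreshold lam u = |u| * max (|u| - lam) 0 := by
  unfold softThreshold
  split_ifs with h1 h2
  · rw [abs_of_neg (by linarith), max_eq_left (by linarith)]; ring
  · rw [abs_of_pos (by linarith), max_eq_left (by linarith)]
  · rw [max_eq_right (by linarith [abs_le.2 ⟨not_lt.1 h1, not_lt.1 h2⟩]), mul_zero, mul_zero]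

/-- The scalar objective is 1-strongly convex, so its excess over the minimum is at least half the
squared distance to the minimizer. This surplus later yields uniqueness as well as optimality. -/
lemma softThreshold_variational {lam : ℝ} (hlam : 0 ≤ lam) (u b : ℝ) :
    1 / 2 * softThreshold lam u ^ 2 - u * softThreshold lam u + lam * |softThreshold lam u|
      + 1 / 2 * (b - softThreshold lam u) ^ 2 ≤ 1 / 2 * b ^ 2 - u * b + lam * |b| := by
  unfold softThreshold
  split_ifs with h1 h2
  · rw [abs_of_neg (by linarith)]
    nlinarith [mul_nonneg hlam (by linarith [neg_abs_le b] : 0 ≤ |b| + b)]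
  · rw [abs_of_pos (by linarith)]
    nlinarith [mul_nonneg hlam (by linarith [le_abs_self b] : 0 ≤ |b| - b)]
  · rw [abs_zero]
    have : u * b ≤ lam * |b| := by
      rcases abs_cases b with ⟨h, h'⟩ | ⟨h, h'⟩ <;> rw [h] <;> nlinarith
    nlinarith

/-- Orthonormality gives `‖X b‖ = ‖b‖`, so the objective becomes a constant plus a sum of scalar
problems. -/
lemma lassoObjective_eq {n : ℕ} {ι : Type*} [Fintype ι] [DecidableEq ι]
    (X : Matrix (Fin n) ι ℝ) (hX : Xᵀ * X = 1) (y : Fin n → ℝ) (lam : ℝ) (b : ι → ℝ) :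
    lassoObjective X y lam b = 1 / 2 * (y ⬝ᵥ y) +
      ∑ j, (1 / 2 * b j ^ 2 - (Xᵀ *ᵥ y) j * b j + lam * |b j|) := by
  have h1 : ∑ i, (y i - (X *ᵥ b) i) ^ 2
      = y ⬝ᵥ y - 2 * ((Xᵀ *ᵥ y) ⬝ᵥ b) + b ⬝ᵥ b := by
    have h2 : (X *ᵥ b) ⬝ᵥ (X *ᵥ b) = b ⬝ᵥ b := by
      rw [Matrix.dotProduct_mulVec, Matrix.vecMul_mulVec, hX, Matrix.vecMul_one]
    have h3 : (Xᵀ *ᵥ y) ⬝ᵥ b = y ⬝ᵥ (X *ᵥ b) := by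
      rw [Matrix.dotProduct_mulVec, Matrix.mulVec_transpose]
    rw [h3, ← h2]
    simp only [dotProduct, Finset.mul_sum, ← Finset.sum_sub_distrib, ← Finset.sum_add_distrib]
    exact Finset.sum_congr rfl fun i _ => by ring
  rw [lassoObjective, h1]
  simp only [dotProduct, Finset.mul_sum, Finset.sum_add_distrib, Finset.sum_sub_distrib, mul_add,
    mul_sub]
  have h4 : ∑ j, 1 / 2 * (2 * ((Xᵀ *ᵥ y) j * b j)) = ∑ j, (Xᵀ *ᵥ y) j * b j :=
    Finset.sum_congr rfl fun i _ => by ring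
  have h5 : ∑ j, 1 / 2 * (b j * b j) = ∑ j, 1 / 2 * b j ^ 2 :=
    Finset.sum_congr rfl fun i _ => by ring
  rw [h4, h5]
  ring

/-- `lassoSol` is an arbitrary choice among minimizers; the quadratic surplus of
`softThreshold_variational` forces that choice to be the soft-thresholded vector. -/
lemma lassoSol_eq_softThreshold {n : ℕ} {ι : Type*} [Fintype ι] [DecidableEq ι]
    (X : Matrix (Fin n) ι ℝ) (hX : Xᵀ * X = 1) (y : Fin n → ℝ) {lam : ℝ} (hlam : 0 ≤ lam) :
    lassoSol X y lam = fun j => softThreshold lam ((Xᵀ *ᵥ y) j) := by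
  set s : ι → ℝ := fun j => softThreshold lam ((Xᵀ *ᵥ y) j) with hs
  have key : ∀ b, lassoObjective X y lam s + ∑ j, 1 / 2 * (b j - s j) ^ 2
      ≤ lassoObjective X y lam b := by
    intro b
    rw [lassoObjective_eq X hX, lassoObjective_eq X hX, add_assoc, ← Finset.sum_add_distrib]
    exact add_le_add_right (Finset.sum_le_sum fun j _ => softThreshold_variational hlam _ _) _
  have hex : ∃ b : ι → ℝ, IsMinOn (lassoObjective X y lam) Set.univ b :=
    ⟨s, fun b _ => le_trans
      (le_add_of_nonneg_right (Finset.sum_nonneg fun j _ => by positivity)) (key b)⟩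
  rw [lassoSol, dif_pos hex]
  have hmin := hex.choose_spec
  set c := hex.choose
  have h1 : ∑ j, 1 / 2 * (c j - s j) ^ 2 ≤ 0 := by
    have := hmin (Set.mem_univ s)
    simp only [Set.mem_ofPred_eq] at this
    linarith [key c]
  have h2 := (Finset.sum_eq_zero_iff_of_nonneg (fun j _ => by positivity)).1
    (le_antisymm h1 (Finset.sum_nonneg fun j _ => by positivity))
  funext j
  have := h2 j (Finset.mem_univ j)
  have : (c j - s j) ^ 2 = 0 := by linarith
  exact sub_eq_zero.1 (pow_eq_zero_iff (two_ne_zero) |>.1 this)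

lemma dotProduct_mulVec_lassoSol {n : ℕ} {ι : Type*} [Fintype ι] [DecidableEq ι]
    (X : Matrix (Fin n) ι ℝ) (hX : Xᵀ * X = 1) (y : Fin n → ℝ) {lam : ℝ} (hlam : 0 ≤ lam) :
    y ⬝ᵥ (X *ᵥ lassoSol X y lam) = ∑ j, |(Xᵀ *ᵥ y) j| * max (|(Xᵀ *ᵥ y) j| - lam) 0 := by
  rw [lassoSol_eq_softThreshold X hX y hlam, Matrix.dotProduct_mulVec, ← Matrix.mulVec_transpose]
  exact Finset.sum_congr rfl fun j _ => mul_softThreshold hlam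

lemma support_lassoSol {n p : ℕ} (X : Matrix (Fin n) (Fin p) ℝ) (hX : Xᵀ * X = 1)
    (y : Fin n → ℝ) {lam : ℝ} (hlam : 0 ≤ lam) :
    support (lassoSol X y lam) = Finset.univ.filter fun j => lam < |(Xᵀ *ᵥ y) j| := by
  ext j
  simp [support, lassoSol_eq_softThreshold X hX y hlam, softThreshold_eq_zero_iff hlam]

/-- Column `j` is active exactly for penalties strictly below `|U_j|`, so the active set is locally
constant away from these values. -/
lemma knotSet_eq {n p : ℕ} (X : Matrix (Fin n) (Fin p) ℝ) (hX : Xᵀ * X = 1)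
    (y : Fin n → ℝ) (h0 : ∀ j, 0 < |(Xᵀ *ᵥ y) j|) :
    knotSet X y = Set.range fun j => |(Xᵀ *ᵥ y) j| := by
  ext lam
  constructor
  · rintro ⟨hlam, h⟩
    by_contra hne
    apply h
    have h1 : ∀ j, ∀ᶠ mu in 𝓝 lam, (mu < |(Xᵀ *ᵥ y) j| ↔ lam < |(Xᵀ *ᵥ y) j|) := by
      intro j
      rcases lt_trichotomy lam |(Xᵀ *ᵥ y) j| with hlt | heq | hgt
      · filter_upwards [eventually_lt_nhds hlt] with mu hmu
        simp [hmu, hlt]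
      · exact absurd ⟨j, heq.symm⟩ hne
      · filter_upwards [eventually_gt_nhds hgt] with mu hmu
        simp [hmu.not_gt, hgt.not_gt]
    filter_upwards [eventually_all.2 h1, eventually_gt_nhds hlam] with mu hmu hmu0
    rw [support_lassoSol X hX y hlam.le, support_lassoSol X hX y hmu0.le]
    ext j
    simp [hmu j]
  · rintro ⟨j, rfl⟩
    refine ⟨h0 j, fun h => ?_⟩
    dsimp only at h
    -- At the penalty `|U_j|` column `j` is inactive, but it is active for every nonnegative penalty
    -- just below: equality of the supports fails on the left.
    have h2 : ∀ᶠ mu in 𝓝[<] |(Xᵀ *ᵥ y) j|, False := by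
      filter_upwards [nhdsWithin_le_nhds h, nhdsWithin_le_nhds (eventually_gt_nhds (h0 j)),
        self_mem_nhdsWithin] with mu hmu hmu0 hlt
      rw [support_lassoSol X hX y (h0 j).le, support_lassoSol X hX y (le_of_lt hmu0)] at hmu
      have := congrArg (fun s => j ∈ s) hmu
      simp at this
      exact (not_le.2 hlt) this
    exact h2.exists.elim fun _ h => h

/-! ### Order statistics of a finite family -/

/-- The number of coordinates of `v` that are larger than `v j`. -/
def descRank {ι : Type*} [Fintype ι] (v : ι → ℝ) (j : ι) : ℕ :=
  (Finset.univ.filter fun i => v j < v i).card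

/-- The `k`-th largest coordinate (counting from zero) of a vector with distinct coordinates;
it is `0` when `k` is at least the number of coordinates. -/
def orderStat {ι : Type*} [Fintype ι] (v : ι → ℝ) (k : ℕ) : ℝ :=
  ∑ j, if descRank v j = k then v j else 0

section OrderStat

variable {ι : Type*} [Fintype ι] {v : ι → ℝ}

lemma descRank_lt_descRank {i j : ι} (h : v j < v i) : descRank v i < descRank v j := by
  apply Finset.card_lt_card
  rw [Finset.ssubset_iff_of_subset (Finset.monotone_filter_right _ fun a _ ha => h.trans ha)]
  exact ⟨i, by simpa using h, by simp⟩

lemma descRank_lt_iff (hv : Function.Injective v) {i j : ι} :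
    descRank v i < descRank v j ↔ v j < v i := by
  refine ⟨fun h => ?_, descRank_lt_descRank⟩
  by_contra h'
  rcases (not_lt.1 h').lt_or_eq with h1 | h1
  · exact lt_asymm h (descRank_lt_descRank h1)
  · rw [hv h1] at h
    exact lt_irrefl _ h

lemma descRank_injective (hv : Function.Injective v) : Function.Injective (descRank v) := by
  intro i j h
  by_contra hne
  rcases lt_or_gt_of_ne (hv.ne hne) with h1 | h1
  · exact (descRank_lt_descRank h1).ne' h
  · exact (descRank_lt_descRank h1).ne h

lemma descRank_lt_card (j : ι) : descRank v j < Fintype.card ι := by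
  rw [descRank, ← Finset.card_univ]
  apply Finset.card_lt_card
  rw [Finset.ssubset_iff_of_subset (Finset.subset_univ _)]
  exact ⟨j, by simp, by simp⟩

lemma exists_descRank_eq (hv : Function.Injective v) {k : ℕ} (hk : k < Fintype.card ι) :
    ∃ j, descRank v j = k := by
  have hinj : Function.Injective fun j => (⟨descRank v j, descRank_lt_card j⟩ :
      Fin (Fintype.card ι)) := fun i j h => descRank_injective hv (by simpa using h)
  have hb := (Fintype.bijective_iff_injective_and_card _).2 ⟨hinj, by simp⟩
  obtain ⟨j, hj⟩ := hb.2 ⟨k, hk⟩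
  exact ⟨j, by simpa using congrArg Fin.val hj⟩

lemma orderStat_descRank (hv : Function.Injective v) (j : ι) :
    orderStat v (descRank v j) = v j := by
  classical
  rw [orderStat, Finset.sum_eq_single j]
  · simp
  · intro i _ hi
    rw [if_neg fun h => hi (descRank_injective hv h)]
  · simp

lemma orderStat_of_card_le {k : ℕ} (hk : Fintype.card ι ≤ k) : orderStat v k = 0 :=
  Finset.sum_eq_zero fun j _ => if_neg fun h => by
    have := descRank_lt_card (v := v) j
    omega

lemma orderStat_nonneg (hv : ∀ j, 0 ≤ v j) (k : ℕ) : 0 ≤ orderStat v k :=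
  Finset.sum_nonneg fun j _ => by split_ifs <;> simp [hv]

lemma measurable_orderStat (k : ℕ) : Measurable fun v : ι → ℝ => orderStat v k := by
  unfold orderStat
  refine Finset.measurable_sum _ fun j _ => Measurable.ite ?_ (measurable_pi_apply j)
    measurable_const
  have : Measurable fun v : ι → ℝ => descRank v j := by
    simp only [descRank, Finset.card_filter]
    refine Finset.measurable_sum _ fun i _ => Measurable.ite ?_ measurable_const measurable_const
    exact measurableSet_lt (measurable_pi_apply j) (measurable_pi_apply i)
  exact this (measurableSet_singleton k)

/-- Positivity makes the default value `0` of `orderStat` lie below every coordinate, so no bound on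
`k` is needed. -/
lemma lt_orderStat_iff (hv : Function.Injective v) (h0 : ∀ j, 0 < v j) (k : ℕ) (j : ι) :
    orderStat v k < v j ↔ descRank v j < k := by
  by_cases hk : k < Fintype.card ι
  · obtain ⟨i, rfl⟩ := exists_descRank_eq hv hk
    rw [orderStat_descRank hv, descRank_lt_iff hv]
  · rw [orderStat_of_card_le (not_lt.1 hk)]
    simp only [h0, true_iff]
    exact (descRank_lt_card j).trans_le (not_lt.1 hk)

lemma lt_orderStat_iff' (hv : Function.Injective v) (h0 : ∀ j, 0 < v j) (k : ℕ) (j : ι) :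
    v j < orderStat v k ↔ k < descRank v j := by
  by_cases hk : k < Fintype.card ι
  · obtain ⟨i, rfl⟩ := exists_descRank_eq hv hk
    rw [orderStat_descRank hv, descRank_lt_iff hv]
  · rw [orderStat_of_card_le (not_lt.1 hk)]
    have := descRank_lt_card (v := v) j
    simp only [(h0 j).not_gt, false_iff]
    omega

lemma orderStat_succ_le (hv : Function.Injective v) (h0 : ∀ j, 0 < v j) (k : ℕ) :
    orderStat v (k + 1) ≤ orderStat v k := by
  by_cases hk : k < Fintype.card ι
  · obtain ⟨i, hi⟩ := exists_descRank_eq hv hk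
    have := orderStat_descRank hv i
    rw [hi] at this
    rw [this]
    exact ((lt_orderStat_iff hv h0 (k + 1) i).2 (by omega)).le
  · rw [orderStat_of_card_le (by omega), orderStat_of_card_le (by omega)]

lemma isGreatest_orderStat (hv : Function.Injective v) {k : ℕ}
    (hk : k < Fintype.card ι) : IsGreatest (v '' {j | k ≤ descRank v j}) (orderStat v k) := by
  obtain ⟨i, rfl⟩ := exists_descRank_eq hv hk
  rw [orderStat_descRank hv]
  refine ⟨⟨i, by simp, rfl⟩, ?_⟩
  rintro _ ⟨j, hj, rfl⟩
  by_contra h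
  exact absurd (descRank_lt_descRank (not_le.1 h)) (not_lt.2 hj)

lemma sSup_image_descRank (hv : Function.Injective v) (k : ℕ) :
    sSup (v '' {j | k ≤ descRank v j}) = orderStat v k := by
  by_cases hk : k < Fintype.card ι
  · exact (isGreatest_orderStat hv hk).csSup_eq
  · have : {j | k ≤ descRank v j} = ∅ := by
      ext j
      have := descRank_lt_card (v := v) j
      simp; omega
    rw [this, Set.image_empty, Real.sSup_empty, orderStat_of_card_le (not_lt.1 hk)]

/-- A strictly increasing transformation preserves ranks. The bound on `k` is there because `f 0`
need not be the default value `0`. -/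
lemma orderStat_comp (hv : Function.Injective v) {f : ℝ → ℝ}
    (hf : ∀ i j, v i < v j ↔ f (v i) < f (v j)) {k : ℕ} (hk : k < Fintype.card ι) :
    orderStat (fun j => f (v j)) k = f (orderStat v k) := by
  have hinj : Function.Injective fun j => f (v j) := by
    intro i j h
    by_contra hne
    rcases lt_or_gt_of_ne (hv.ne hne) with h1 | h1
    · exact ((hf _ _).1 h1).ne h
    · exact ((hf _ _).1 h1).ne' h
  obtain ⟨i, rfl⟩ := exists_descRank_eq hv hk
  have hr : descRank v i = descRank (fun j => f (v j)) i := by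
    simp only [descRank, hf]
  rw [orderStat_descRank hv, hr, orderStat_descRank hinj]

/-- When the coordinates in `S` dominate the others, they occupy the first `S.card` ranks, and every
other rank is the rank within the complement shifted by `S.card`. This removes the signals. -/
lemma orderStat_card_add [DecidableEq ι] (hv : Function.Injective v) (S : Finset ι)
    (hS : ∀ i ∈ S, ∀ j ∉ S, v j < v i) (k : ℕ) :
    orderStat v (S.card + k) = orderStat (fun j : {j // j ∉ S} => v j) k := by
  have hinj : Function.Injective fun j : {j // j ∉ S} => v j := hv.comp Subtype.val_injective
  have hcard : Fintype.card {j // j ∉ S} = Fintype.card ι - S.card := by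
    rw [Fintype.card_subtype_compl, Fintype.card_coe]
  by_cases hk : k < Fintype.card {j // j ∉ S}
  · obtain ⟨i, rfl⟩ := exists_descRank_eq hinj hk
    have hr : descRank v i = S.card + descRank (fun j : {j // j ∉ S} => v j) i := by
      have h1 : (Finset.univ.filter fun j => v i < v j) =
          S ∪ (Finset.univ.filter fun j : {j // j ∉ S} => v i < v j).map
            (Function.Embedding.subtype _) := by
        ext j
        by_cases hj : j ∈ S
        · simp [hj, hS j hj i i.2]
        · simp [hj]
      rw [descRank, h1, Finset.card_union_of_disjoint, Finset.card_map, descRank]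
      rw [Finset.disjoint_left]
      intro j hj hj'
      simp only [Finset.mem_map, Function.Embedding.coe_subtype] at hj'
      obtain ⟨a, -, rfl⟩ := hj'
      exact a.2 hj
    rw [orderStat_descRank hinj, ← hr, orderStat_descRank hv]
  · rw [orderStat_of_card_le (not_lt.1 hk), orderStat_of_card_le]
    omega

end OrderStat

/-! ### Knots and test statistics as order statistics -/

/-- Knots count from one and order statistics from zero. Once the values are exhausted both are `0`,
since `sSup ∅ = 0`. -/
lemma knot_succ_eq_orderStat {n p : ℕ} (X : Matrix (Fin n) (Fin p) ℝ) (hX : Xᵀ * X = 1)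
    (y : Fin n → ℝ) (h0 : ∀ j, 0 < |(Xᵀ *ᵥ y) j|)
    (hinj : Function.Injective fun j => |(Xᵀ *ᵥ y) j|) (k : ℕ) :
    knot X y (k + 1) = orderStat (fun j => |(Xᵀ *ᵥ y) j|) k := by
  induction k with
  | zero =>
    rw [← sSup_image_descRank hinj]
    simp only [knot, knotSet_eq X hX y h0, zero_le, Set.ofPred_true, Set.image_univ]
  | succ k ih =>
    rw [← sSup_image_descRank hinj]
    simp only [knot, ih, knotSet_eq X hX y h0]
    congr 1
    ext x
    constructor
    · rintro ⟨⟨j, rfl⟩, hj⟩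
      exact ⟨j, (lt_orderStat_iff' hinj h0 k j).1 hj, rfl⟩
    · rintro ⟨j, hj, rfl⟩
      exact ⟨⟨j, rfl⟩, (lt_orderStat_iff' hinj h0 k j).2 hj⟩

lemma activeBefore_eq {n p : ℕ} (X : Matrix (Fin n) (Fin p) ℝ) (hX : Xᵀ * X = 1)
    (y : Fin n → ℝ) {k : ℕ} (hk : 0 ≤ knot X y k) :
    activeBefore X y k = Finset.univ.filter fun j => knot X y k < |(Xᵀ *ᵥ y) j| := by
  classical
  ext j
  simp only [activeBefore, Finset.mem_filter, Finset.mem_univ, true_and]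
  have h : (∀ᶠ lam in 𝓝[>] knot X y k, lassoSol X y lam j ≠ 0) ↔
      ∀ᶠ lam in 𝓝[>] knot X y k, lam < |(Xᵀ *ᵥ y) j| := by
    apply eventually_congr
    filter_upwards [self_mem_nhdsWithin] with lam hlam
    have hlam0 : 0 ≤ lam := hk.trans (le_of_lt hlam)
    rw [lassoSol_eq_softThreshold X hX y hlam0, Ne, softThreshold_eq_zero_iff hlam0, not_le]
  rw [h]
  constructor
  · intro h
    obtain ⟨lam, h1, h2⟩ := (h.and self_mem_nhdsWithin).exists
    exact lt_trans h2 h1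
  · intro h
    exact nhdsWithin_le_nhds (eventually_lt_nhds h)

lemma colSubmatrix_transpose_mul_self {n p : ℕ} (X : Matrix (Fin n) (Fin p) ℝ) (hX : Xᵀ * X = 1)
    (M : Finset (Fin p)) : (colSubmatrix X M)ᵀ * colSubmatrix X M = 1 := by
  ext i j
  have := congrFun (congrFun hX i) j
  rw [Matrix.one_apply] at this ⊢
  simp only [Matrix.mul_apply, Matrix.transpose_apply, colSubmatrix, Matrix.submatrix_apply, id,
    ← Subtype.ext_iff] at this ⊢
  exact this

/-- Both fits are sums over columns at the same penalty, so the columns of the active set (ranks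
below `k`) cancel. Among the rest, only the column of rank `k` exceeds the penalty, which is the
order statistic of index `k + 1`. -/
lemma testStat_succ_eq {n p : ℕ} (X : Matrix (Fin n) (Fin p) ℝ) (hX : Xᵀ * X = 1) (σ : ℝ)
    (y : Fin n → ℝ) (h0 : ∀ j, 0 < |(Xᵀ *ᵥ y) j|)
    (hinj : Function.Injective fun j => |(Xᵀ *ᵥ y) j|) (k : ℕ) :
    testStat X σ y (k + 1) = orderStat (fun j => |(Xᵀ *ᵥ y) j|) k *
      (orderStat (fun j => |(Xᵀ *ᵥ y) j|) k - orderStat (fun j => |(Xᵀ *ᵥ y) j|) (k + 1))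
        / σ ^ 2 := by
  set v : Fin p → ℝ := fun j => |(Xᵀ *ᵥ y) j| with hv
  have hk : ∀ k, knot X y (k + 1) = orderStat v k := knot_succ_eq_orderStat X hX y h0 hinj
  have hnn : ∀ k, 0 ≤ orderStat v k := orderStat_nonneg fun j => (h0 j).le
  have hM : activeBefore X y (k + 1) = Finset.univ.filter fun j => descRank v j < k := by
    rw [activeBefore_eq X hX y (by rw [hk]; exact hnn k), hk]
    ext j
    simpa using lt_orderStat_iff hinj h0 k j
  rw [testStat, dotProduct_mulVec_lassoSol X hX y (by rw [hk]; exact hnn _),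
    dotProduct_mulVec_lassoSol _ (colSubmatrix_transpose_mul_self X hX _) y
      (by rw [hk]; exact hnn _), hk]
  congr 1
  have hsub : ∑ j : activeBefore X y (k + 1), |((colSubmatrix X (activeBefore X y (k + 1)))ᵀ *ᵥ y) j|
        * max (|((colSubmatrix X (activeBefore X y (k + 1)))ᵀ *ᵥ y) j| - orderStat v (k + 1)) 0
      = ∑ j ∈ activeBefore X y (k + 1), v j * max (v j - orderStat v (k + 1)) 0 := by
    exact Finset.sum_coe_sort (activeBefore X y (k + 1))
      fun j => v j * max (v j - orderStat v (k + 1)) 0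
  rw [hsub, hM, sub_eq_iff_eq_add, ← Finset.sum_filter_add_sum_filter_not Finset.univ
    (fun j => descRank v j < k), add_comm]
  congr 1
  by_cases hkc : k < Fintype.card (Fin p)
  · obtain ⟨i, hi⟩ := exists_descRank_eq hinj hkc
    have hvi := orderStat_descRank hinj i
    rw [hi] at hvi
    rw [Finset.sum_eq_single i, hvi, max_eq_left]
    · exact sub_nonneg.2 ((orderStat_succ_le hinj h0 k).trans_eq hvi)
    · intro j hj hji
      have h1 : ¬ descRank v j < k := (Finset.mem_filter.1 hj).2
      have h2 : descRank v j ≠ k := fun h => hji (descRank_injective hinj (h.trans hi.symm))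
      have h3 : v j ≤ orderStat v (k + 1) := by
        rw [← not_lt, lt_orderStat_iff hinj h0]
        omega
      rw [max_eq_right (by linarith), mul_zero]
    · intro h
      exact absurd (Finset.mem_filter.2 ⟨Finset.mem_univ i, by rw [hi]; exact lt_irrefl k⟩) h
  · rw [orderStat_of_card_le (not_lt.1 hkc), zero_mul]
    apply Finset.sum_eq_zero
    intro j hj
    have h1 : ¬ descRank v j < k := (Finset.mem_filter.1 hj).2
    exact absurd ((descRank_lt_card j).trans_le (not_lt.1 hkc)) h1

/-! ### The score vector `Xᵀ y` in the Gaussian linear model -/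

section Gaussian

variable {n p : ℕ} {Ω : Type*} {X : Matrix (Fin n) (Fin p) ℝ}
  {β : Fin p → ℝ} {σ : ℝ} {y : Ω → Fin n → ℝ}

/-- The standardized scores `(Xⱼᵀ y - βⱼ) / σ`. -/
def standardScore (X : Matrix (Fin n) (Fin p) ℝ) (β : Fin p → ℝ) (σ : ℝ) (y : Ω → Fin n → ℝ)
    (j : Fin p) (ω : Ω) : ℝ :=
  ((Xᵀ *ᵥ y ω) j - β j) / σ

lemma score_eq (hσ : 0 < σ) (j : Fin p) (ω : Ω) :
    (Xᵀ *ᵥ y ω) j = β j + σ * standardScore X β σ y j ω := by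
  rw [standardScore]
  field_simp
  ring

lemma standardScore_eq_sum (hX : Xᵀ * X = 1) (j : Fin p) (ω : Ω) :
    standardScore X β σ y j ω = ∑ i, (X i j / σ) * (y ω i - (X *ᵥ β) i) := by
  have h1 : (Xᵀ *ᵥ y ω) j - β j = (Xᵀ *ᵥ (y ω - X *ᵥ β)) j := by
    rw [Matrix.mulVec_sub, Matrix.mulVec_mulVec, hX, Matrix.one_mulVec, Pi.sub_apply]
  rw [standardScore, h1, Matrix.mulVec, dotProduct, Finset.sum_div]
  exact Finset.sum_congr rfl fun i _ => by
    simp only [Matrix.transpose_apply, Pi.sub_apply]; ring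

variable [MeasurableSpace Ω] {P : Measure Ω}

lemma IsGaussianLinearModel.hasGaussianLaw (hy : IsGaussianLinearModel P X β σ y) :
    HasGaussianLaw (fun ω i => y ω i - (X *ᵥ β) i) P :=
  hy.indep.hasGaussianLaw fun i => (hy.law i).hasGaussianLaw

lemma IsGaussianLinearModel.hasGaussianLaw_standardScore (hX : Xᵀ * X = 1)
    (hy : IsGaussianLinearModel P X β σ y) :
    HasGaussianLaw (fun ω j => standardScore X β σ y j ω) P := by
  have h := hy.hasGaussianLaw.map_fun
    (LinearMap.toContinuousLinearMap (Matrix.mulVecLin (Matrix.of fun j i => X i j / σ)))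
  refine h.congr (ae_of_all _ fun ω => ?_)
  funext j
  exact (standardScore_eq_sum hX j ω).symm

variable [IsProbabilityMeasure P]

/-- The noise has covariance `σ² I`, so the covariance of the standardized scores is `Xᵀ X = 1`. -/
lemma IsGaussianLinearModel.covariance_standardScore (hσ : 0 < σ) (hX : Xᵀ * X = 1)
    (hy : IsGaussianLinearModel P X β σ y) (j k : Fin p) :
    cov[standardScore X β σ y j, standardScore X β σ y k; P] = if j = k then 1 else 0 := by
  have hL : ∀ i, MemLp (fun ω => y ω i - (X *ᵥ β) i) 2 P := fun i =>
    (hy.law i).hasGaussianLaw.memLp_two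
  have hcov : ∀ i l, cov[fun ω => y ω i - (X *ᵥ β) i, fun ω => y ω l - (X *ᵥ β) l; P]
      = if i = l then σ ^ 2 else 0 := by
    intro i l
    split_ifs with h
    · subst h
      rw [covariance_self (hy.law i).aemeasurable, (hy.law i).variance_eq]
      simp [variance_id_gaussianReal, sq_nonneg]
    · exact (hy.indep.indepFun h).covariance_eq_zero (hL i) (hL l)
  have hf : ∀ j, standardScore X β σ y j = fun ω => ∑ i, (X i j / σ) * (y ω i - (X *ᵥ β) i) :=
    fun j => funext fun ω => standardScore_eq_sum hX j ω
  rw [hf, hf, covariance_fun_sum_fun_sum (fun i => (hL i).const_mul _)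
    (fun i => (hL i).const_mul _)]
  simp only [covariance_const_mul_left, covariance_const_mul_right, hcov, mul_ite, mul_zero,
    Finset.sum_ite_eq, Finset.mem_univ, if_true]
  have := congrFun (congrFun hX j) k
  rw [Matrix.one_apply] at this
  rw [← this, Matrix.mul_apply]
  refine Finset.sum_congr rfl fun i _ => ?_
  rw [Matrix.transpose_apply]
  field_simp

/-- Jointly Gaussian uncorrelated variables are independent. -/
lemma IsGaussianLinearModel.iIndepFun_standardScore (hσ : 0 < σ) (hX : Xᵀ * X = 1)
    (hy : IsGaussianLinearModel P X β σ y) : iIndepFun (standardScore X β σ y) P :=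
  (hy.hasGaussianLaw_standardScore hX).iIndepFun_of_covariance_eq_zero fun j k hjk => by
    rw [hy.covariance_standardScore hσ hX, if_neg hjk]

lemma IsGaussianLinearModel.hasLaw_standardScore (hσ : 0 < σ) (hX : Xᵀ * X = 1)
    (hy : IsGaussianLinearModel P X β σ y) (j : Fin p) :
    HasLaw (standardScore X β σ y j) (gaussianReal 0 1) P := by
  have hG : HasGaussianLaw (standardScore X β σ y j) P :=
    (hy.hasGaussianLaw_standardScore hX).eval j
  refine ⟨hG.aemeasurable, ?_⟩
  have hvar : Var[standardScore X β σ y j; P] = 1 := by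
    rw [← covariance_self hG.aemeasurable, hy.covariance_standardScore hσ hX, if_pos rfl]
  have hmean : P[standardScore X β σ y j] = 0 := by
    have hf : standardScore X β σ y j = fun ω => ∑ i, (X i j / σ) * (y ω i - (X *ᵥ β) i) :=
      funext fun ω => standardScore_eq_sum hX j ω
    rw [hf, integral_finsetSum _
      fun i _ => (hy.law i).hasGaussianLaw.integrable.const_mul _]
    refine Finset.sum_eq_zero fun i _ => ?_
    rw [integral_const_mul, (hy.law i).integral_eq, integral_id_gaussianReal, mul_zero]
  rw [hG.map_eq_gaussianReal, hmean, hvar]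
  simp

end Gaussian

/-! ### Almost sure absence of ties -/

/-- Independent random variables coincide with probability zero if one law has no atoms. -/
lemma ae_ne_of_indepFun {Ω : Type*} [MeasurableSpace Ω] {P : Measure Ω} [IsProbabilityMeasure P]
    {A B : Ω → ℝ} (hA : AEMeasurable A P) (hB : AEMeasurable B P) (h : IndepFun A B P)
    (hat : ∀ t, P (A ⁻¹' {t}) = 0) : ∀ᵐ ω ∂P, A ω ≠ B ω := by
  have := Measure.isProbabilityMeasure_map hA
  have := Measure.isProbabilityMeasure_map hB
  have hmap := (indepFun_iff_map_prod_eq_prod_map_map hA hB).1 h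
  have hS : MeasurableSet {q : ℝ × ℝ | q.1 = q.2} :=
    measurableSet_eq_fun measurable_fst measurable_snd
  have h1 : (P.map fun ω => (A ω, B ω)) {q : ℝ × ℝ | q.1 = q.2} = 0 := by
    -- Fubini with the coordinate of `B` held fixed: the section of the diagonal is a point, null
    -- for the law of `A`. The law of `B` may have atoms.
    rw [hmap, Measure.prod_apply_symm hS]
    refine (lintegral_eq_zero_iff' ?_).2 (ae_of_all _ fun b => ?_)
    · exact (measurable_measure_prodMk_right hS).aemeasurable
    · have : (fun a : ℝ => (a, b)) ⁻¹' {q : ℝ × ℝ | q.1 = q.2} = {b} := by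
        ext a; simp
      beta_reduce
      rw [this, Measure.map_apply_of_aemeasurable hA (measurableSet_singleton b), hat]
      rfl
  rw [Measure.map_apply_of_aemeasurable (hA.prodMk hB) hS] at h1
  exact measure_eq_zero_iff_ae_notMem.1 h1

lemma ae_injective_of_iIndepFun {ι Ω : Type*} [Finite ι] [MeasurableSpace Ω] {P : Measure Ω}
    [IsProbabilityMeasure P] {A : ι → Ω → ℝ} (hA : ∀ i, AEMeasurable (A i) P)
    (h : iIndepFun A P) (hat : ∀ i t, P (A i ⁻¹' {t}) = 0) :
    ∀ᵐ ω ∂P, Function.Injective fun i => A i ω := by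
  have : ∀ i j, ∀ᵐ ω ∂P, i ≠ j → A i ω ≠ A j ω := by
    intro i j
    by_cases hij : i = j
    · exact ae_of_all _ fun ω h => absurd hij h
    · filter_upwards [ae_ne_of_indepFun (hA i) (hA j) (h.indepFun hij) (hat i)] with ω hω _
      exact hω
  filter_upwards [ae_all_iff.2 fun i => ae_all_iff.2 (this i)] with ω hω i j hij
  by_contra hne
  exact hω i j hne hij

/-! ### Spacings of independent exponential variables -/

open scoped ENNReal

lemma expMeasure_Ioi {r s : ℝ} (hr : 0 < r) (hs : 0 ≤ s) :
    expMeasure r (Set.Ioi s) = ENNReal.ofReal (Real.exp (-(r * s))) := by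
  have := isProbabilityMeasure_expMeasure hr
  have h := cdf_expMeasure_eq hr s
  rw [if_pos hs, cdf_eq_real] at h
  rw [← Set.compl_Iic, ← ofReal_measureReal, probReal_compl_eq_one_sub measurableSet_Iic, h]
  congr 1
  ring

lemma expMeasure_Ioi_of_nonpos {r s : ℝ} (hr : 0 < r) (hs : s ≤ 0) :
    expMeasure r (Set.Ioi s) = 1 := by
  have := isProbabilityMeasure_expMeasure hr
  refine le_antisymm prob_le_one ?_
  calc (1 : ℝ≥0∞) = expMeasure r (Set.Ioi 0) := by rw [expMeasure_Ioi hr le_rfl]; simp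
    _ ≤ expMeasure r (Set.Ioi s) := measure_mono (Set.Ioi_subset_Ioi hs)

lemma expMeasure_singleton (r t : ℝ) : expMeasure r {t} = 0 :=
  withDensity_absolutelyContinuous _ _ (by simp)

/-- The memoryless property of the exponential distribution. -/
lemma expMeasure_inter_Ici {v : ℝ} (hv : 0 ≤ v) {S : Set ℝ} (hS : MeasurableSet S) :
    expMeasure 1 (S ∩ Set.Ici v) =
      ENNReal.ofReal (Real.exp (-v)) * expMeasure 1 ((fun x => x + v) ⁻¹' S) := by
  have hS' : MeasurableSet ((fun x => x + v) ⁻¹' S) := (measurable_add_const v) hS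
  change volume.withDensity (exponentialPDF 1) _ = _ * volume.withDensity (exponentialPDF 1) _
  have hm : Measurable (exponentialPDF 1) := (measurable_exponentialPDFReal 1).ennreal_ofReal
  rw [withDensity_apply _ (hS.inter measurableSet_Ici), withDensity_apply _ hS',
    ← lintegral_indicator (hS.inter measurableSet_Ici), ← lintegral_indicator hS',
    ← lintegral_const_mul _ (hm.indicator hS'), ← lintegral_add_right_eq_self _ v]
  refine lintegral_congr fun x => ?_
  by_cases hx : 0 ≤ x
  · by_cases hxS : x + v ∈ S
    · have hmem : x + v ∈ S ∩ Set.Ici v := ⟨hxS, by simpa using hx⟩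
      rw [Set.indicator_of_mem hmem,
        Set.indicator_of_mem (show x ∈ (fun x => x + v) ⁻¹' S from hxS),
        exponentialPDF_of_nonneg hx, exponentialPDF_of_nonneg (by linarith),
        ← ENNReal.ofReal_mul (Real.exp_pos _).le, one_mul, one_mul, one_mul, one_mul,
        ← Real.exp_add]
      congr 2
      ring
    · rw [Set.indicator_of_notMem (fun h => hxS h.1),
        Set.indicator_of_notMem (show x ∉ (fun x => x + v) ⁻¹' S from hxS), mul_zero]
  · rw [Set.indicator_of_notMem (fun h => hx (by simpa using h.2))]
    simp [Set.indicator, exponentialPDF_of_neg (not_le.1 hx)]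

section Renyi

variable {ι : Type*} [Fintype ι]

/-- The joint law of independent unit exponential variables. -/
def unitExpLaw (ι : Type*) [Fintype ι] : Measure (ι → ℝ) := Measure.pi fun _ => expMeasure 1

instance : IsProbabilityMeasure (expMeasure 1) := isProbabilityMeasure_expMeasure one_pos

instance : IsProbabilityMeasure (unitExpLaw ι) := by unfold unitExpLaw; infer_instance

/-- The memoryless property applied to each coordinate: conditioned on `x ≥ v`, the vector `x - v`
again has law `unitExpLaw ι`. Uniqueness of the product measure extends this from boxes to all
measurable sets. -/
lemma unitExpLaw_inter_Ici {v : ι → ℝ} (hv : ∀ i, 0 ≤ v i) {A : Set (ι → ℝ)}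
    (hA : MeasurableSet A) :
    unitExpLaw ι (A ∩ Set.Ici v) =
      ENNReal.ofReal (Real.exp (-∑ i, v i)) * unitExpLaw ι ((fun x => x + v) ⁻¹' A) := by
  have hsub : Measurable fun x : ι → ℝ => x - v := measurable_sub_const v
  have hB : MeasurableSet (Set.Ici v) := measurableSet_Ici
  have key : unitExpLaw ι = ENNReal.ofReal (Real.exp (∑ i, v i)) •
      ((unitExpLaw ι).restrict (Set.Ici v)).map (fun x => x - v) := by
    refine Measure.pi_eq fun s hs => ?_
    rw [Measure.smul_apply, Measure.map_apply hsub (MeasurableSet.univ_pi hs),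
      Measure.restrict_apply (hsub (MeasurableSet.univ_pi hs))]
    have hset : (fun x : ι → ℝ => x - v) ⁻¹' Set.univ.pi s ∩ Set.Ici v
        = Set.univ.pi fun i => (fun t => t - v i) ⁻¹' s i ∩ Set.Ici (v i) := by
      ext x
      simp [Set.mem_pi, Pi.le_def, forall_and]
    rw [hset, unitExpLaw, Measure.pi_pi]
    have hi : ∀ i, expMeasure 1 ((fun t => t - v i) ⁻¹' s i ∩ Set.Ici (v i)) =
        ENNReal.ofReal (Real.exp (-v i)) * expMeasure 1 (s i) := by
      intro i
      rw [expMeasure_inter_Ici (hv i) (measurable_sub_const (v i) (hs i))]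
      congr 2
      ext t
      simp
    simp_rw [hi]
    rw [Finset.prod_mul_distrib, ← ENNReal.ofReal_prod_of_nonneg fun i _ => (Real.exp_pos _).le,
      ← Real.exp_sum, smul_eq_mul, ← mul_assoc, ← ENNReal.ofReal_mul (Real.exp_pos _).le,
      ← Real.exp_add]
    simp
  have hA' : MeasurableSet ((fun x => x + v) ⁻¹' A) := (measurable_add_const v) hA
  have h2 := congrArg (fun μ => μ ((fun x => x + v) ⁻¹' A)) key
  simp only [Measure.smul_apply, smul_eq_mul] at h2
  rw [Measure.map_apply hsub hA', Measure.restrict_apply (hsub hA')] at h2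
  rw [h2, ← mul_assoc, ← ENNReal.ofReal_mul (Real.exp_pos _).le, ← Real.exp_add]
  have h3 : (fun x : ι → ℝ => x - v) ⁻¹' ((fun x => x + v) ⁻¹' A) = A := by
    ext x; simp
  simp [h3]

/-- The coordinates of `x` enumerated by `τ`, extended by zero. -/
def enumCoord {m : ℕ} (τ : Fin m ≃ ι) (x : ι → ℝ) (k : ℕ) : ℝ :=
  if h : k < m then x (τ ⟨k, h⟩) else 0

/-- The cone of vectors whose coordinates, enumerated by `τ`, decrease to zero with gaps larger
than `s`. -/
def gapCone {m : ℕ} (τ : Fin m ≃ ι) (s : ℕ → ℝ) : Set (ι → ℝ) :=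
  {x | ∀ k < m, enumCoord τ x (k + 1) + s k < enumCoord τ x k}

section GapCone

variable {m : ℕ} (τ : Fin m ≃ ι) {s : ℕ → ℝ} {x : ι → ℝ}

omit [Fintype ι] in
lemma enumCoord_symm (i : ι) : enumCoord τ x (τ.symm i) = x i := by
  simp [enumCoord]

omit [Fintype ι] in
lemma measurableSet_gapCone : MeasurableSet (gapCone τ s) := by
  have h : ∀ k, Measurable fun x : ι → ℝ => enumCoord τ x k := by
    intro k
    unfold enumCoord
    split_ifs
    · exact measurable_pi_apply _
    · exact measurable_const
  simp only [gapCone, Set.ofPred_forall]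
  exact MeasurableSet.iInter fun k => MeasurableSet.iInter fun _ =>
    measurableSet_lt ((h _).add_const _) (h _)

omit [Fintype ι] in
lemma enumCoord_lt_of_mem_gapCone (hs : ∀ k, 0 ≤ s k) (hx : x ∈ gapCone τ s) {k l : ℕ}
    (hkl : k < l) (hl : l ≤ m) : enumCoord τ x l < enumCoord τ x k := by
  induction l, hkl using Nat.le_induction with
  | base => linarith [hx k (by omega), hs k]
  | succ l hl' ih => linarith [hx l (by omega), hs l, ih (by omega)]

omit [Fintype ι] in
lemma coord_lt_iff_of_mem_gapCone (hs : ∀ k, 0 ≤ s k) (hx : x ∈ gapCone τ s) (k l : Fin m) :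
    x (τ l) < x (τ k) ↔ k < l := by
  have h : ∀ k l : Fin m, k < l → x (τ l) < x (τ k) := by
    intro k l hkl
    have := enumCoord_lt_of_mem_gapCone τ hs hx (Fin.lt_def.1 hkl) l.2.le
    simpa [enumCoord, k.2, l.2] using this
  refine ⟨fun hlt => ?_, h k l⟩
  by_contra hkl
  rcases (not_lt.1 hkl).lt_or_eq with h1 | h1
  · exact lt_asymm hlt (h l k h1)
  · rw [h1] at hlt
    exact lt_irrefl _ hlt

lemma descRank_of_mem_gapCone (hs : ∀ k, 0 ≤ s k) (hx : x ∈ gapCone τ s) (k : Fin m) :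
    descRank x (τ k) = k := by
  have h : (Finset.univ.filter fun i => x (τ k) < x i) = (Finset.Iio k).map τ.toEmbedding := by
    ext i
    obtain ⟨l, rfl⟩ := τ.surjective i
    simp [coord_lt_iff_of_mem_gapCone τ hs hx]
  rw [descRank, h, Finset.card_map, Fin.card_Iio]

omit [Fintype ι] in
lemma injective_of_mem_gapCone (hs : ∀ k, 0 ≤ s k) (hx : x ∈ gapCone τ s) :
    Function.Injective x := by
  intro i j hij
  obtain ⟨k, rfl⟩ := τ.surjective i
  obtain ⟨l, rfl⟩ := τ.surjective j
  have h1 := (coord_lt_iff_of_mem_gapCone τ hs hx k l).not.1 hij.symm.not_lt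
  have h2 := (coord_lt_iff_of_mem_gapCone τ hs hx l k).not.1 hij.not_lt
  rw [le_antisymm (not_lt.1 h2) (not_lt.1 h1)]

omit [Fintype ι] in
lemma nonneg_of_mem_gapCone (hs : ∀ k, 0 ≤ s k) (hx : x ∈ gapCone τ s) (i : ι) : 0 ≤ x i := by
  have h := enumCoord_lt_of_mem_gapCone τ hs hx (τ.symm i).2 le_rfl
  rw [enumCoord_symm] at h
  simpa [enumCoord] using h.le

lemma orderStat_eq_enumCoord (hx : Function.Injective x) (hτ : ∀ k, descRank x (τ k) = k)
    (k : ℕ) : orderStat x k = enumCoord τ x k := by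
  unfold enumCoord
  split_ifs with h
  · rw [← orderStat_descRank hx, hτ]
  · apply orderStat_of_card_le
    rw [← Fintype.card_congr τ, Fintype.card_fin]
    omega

/-- The amount by which each coordinate moves when the gaps grow by `s`. -/
def gapShift (s : ℕ → ℝ) (i : ι) : ℝ := ∑ l ∈ Finset.Ico (τ.symm i : ℕ) m, s l

omit [Fintype ι] in
lemma enumCoord_gapShift {k : ℕ} (hk : k ≤ m) :
    enumCoord τ (gapShift τ s) k = ∑ l ∈ Finset.Ico k m, s l := by
  unfold enumCoord gapShift
  split_ifs with h
  · simp
  · rw [Finset.Ico_eq_empty h, Finset.sum_empty]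

omit [Fintype ι] in
-- Translation by `gapShift τ s` enlarges the gap after rank `k` by exactly `s k`.
lemma preimage_add_gapShift :
    (fun x => x + gapShift τ s) ⁻¹' gapCone τ s = gapCone τ 0 := by
  ext x
  simp only [Set.mem_preimage, gapCone, Set.mem_ofPred_eq, Pi.zero_apply, add_zero]
  refine forall₂_congr fun k hk => ?_
  have hadd : ∀ k, enumCoord τ (x + gapShift τ s) k
      = enumCoord τ x k + enumCoord τ (gapShift τ s) k := by
    intro k
    unfold enumCoord
    split_ifs <;> simp
  rw [hadd, hadd, enumCoord_gapShift τ hk.le, enumCoord_gapShift τ (Nat.succ_le_of_lt hk),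
    Finset.sum_eq_sum_Ico_succ_bot hk]
  constructor <;> intro h <;> linarith

/-- Enlarging the gap of index `k` moves the `k + 1` coordinates above it. This count is the source
of the rates `k + 1` in the limit law. -/
lemma sum_gapShift : ∑ i, gapShift τ s i = ∑ k ∈ Finset.range m, ((k : ℝ) + 1) * s k := by
  rw [← Equiv.sum_comp τ]
  simp only [gapShift, Equiv.symm_apply_apply]
  rw [Fin.sum_univ_eq_sum_range (fun k => ∑ l ∈ Finset.Ico k m, s l)]
  rw [Finset.sum_comm' (t' := Finset.range m) (s' := fun l => Finset.range (l + 1))]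
  · simp
  · intro k l
    simp only [Finset.mem_range, Finset.mem_Ico]
    omega

/-- The cone with gaps `s` is a translate of the cone with gaps zero and lies above the translation
vector, so memorylessness compares the two masses. -/
lemma unitExpLaw_gapCone (hs : ∀ k, 0 ≤ s k) :
    unitExpLaw ι (gapCone τ s) =
      ENNReal.ofReal (Real.exp (-∑ k ∈ Finset.range m, ((k : ℝ) + 1) * s k)) *
        unitExpLaw ι (gapCone τ 0) := by
  have hsub : gapCone τ s ⊆ Set.Ici (gapShift τ s) := by
    intro x hx i
    have h1 : x - gapShift τ s ∈ gapCone τ 0 := by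
      rw [← preimage_add_gapShift τ (s := s)]
      simpa using hx
    have := nonneg_of_mem_gapCone τ (fun _ => le_rfl) h1 i
    simpa using this
  rw [← Set.inter_eq_left.2 hsub, unitExpLaw_inter_Ici (v := gapShift τ s)
    (fun i => Finset.sum_nonneg fun l _ => hs l) (measurableSet_gapCone τ),
    preimage_add_gapShift, sum_gapShift]

end GapCone

/-- The spacing between consecutive decreasing order statistics. -/
def spacing (x : ι → ℝ) (k : ℕ) : ℝ := orderStat x k - orderStat x (k + 1)

lemma measurable_spacing (k : ℕ) : Measurable fun x : ι → ℝ => spacing x k :=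
  (measurable_orderStat k).sub (measurable_orderStat (k + 1))

lemma exists_enumeration {x : ι → ℝ} (hx : Function.Injective x) :
    ∃ τ : Fin (Fintype.card ι) ≃ ι, ∀ k, descRank x (τ k) = k := by
  have hinj : Function.Injective fun j => (⟨descRank x j, descRank_lt_card j⟩ :
      Fin (Fintype.card ι)) := fun i j h => descRank_injective hx (by simpa using h)
  have hb := (Fintype.bijective_iff_injective_and_card _).2 ⟨hinj, by simp⟩
  refine ⟨(Equiv.ofBijective _ hb).symm, fun k => ?_⟩
  have := (Equiv.ofBijective _ hb).apply_symm_apply k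
  exact congrArg Fin.val this

lemma ae_injective_unitExpLaw : ∀ᵐ x ∂(unitExpLaw ι), Function.Injective x := by
  refine ae_injective_of_iIndepFun (A := fun i (x : ι → ℝ) => x i)
    (fun i => (measurable_pi_apply i).aemeasurable)
    (iIndepFun_pi (X := fun _ => id) fun i => aemeasurable_id) fun i t => ?_
  have h := (measurePreserving_eval (fun _ : ι => expMeasure 1) i).measure_preimage
    (measurableSet_singleton t).nullMeasurableSet
  exact h.trans (expMeasure_singleton 1 t)

lemma ae_pos_unitExpLaw : ∀ᵐ x ∂(unitExpLaw ι), ∀ i, 0 < x i := by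
  refine ae_all_iff.2 fun i => ?_
  have h := (measurePreserving_eval (fun _ : ι => expMeasure 1) i).measure_preimage
    (measurableSet_Iic (a := (0 : ℝ))).nullMeasurableSet
  have h0 : expMeasure 1 (Set.Iic (0 : ℝ)) = 0 := by
    rw [← Set.compl_Ioi, prob_compl_eq_zero_iff measurableSet_Ioi,
      expMeasure_Ioi_of_nonpos one_pos le_rfl]
  rw [h0] at h
  filter_upwards [measure_eq_zero_iff_ae_notMem.1 h] with x hx
  simpa using hx

lemma spacing_pos {x : ι → ℝ} (hx : Function.Injective x) (h0 : ∀ i, 0 < x i) {k : ℕ}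
    (hk : k < Fintype.card ι) : 0 < spacing x k := by
  obtain ⟨i, hi⟩ := exists_descRank_eq hx hk
  have := orderStat_descRank hx i
  rw [hi] at this
  rw [spacing, this]
  exact sub_pos.2 ((lt_orderStat_iff hx h0 (k + 1) i).2 (by omega))

/-- Up to a null set, the event is the disjoint union over all orderings `τ` of the cones `gapCone τ
s`. Each cone has the same ratio to its version with `s = 0`, and these versions have total mass one
because all spacings are almost surely positive. -/
lemma unitExpLaw_spacing {s : ℕ → ℝ} (hs : ∀ k, 0 ≤ s k) :
    unitExpLaw ι {x | ∀ k < Fintype.card ι, s k < spacing x k} =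
      ENNReal.ofReal (Real.exp (-∑ k ∈ Finset.range (Fintype.card ι), ((k : ℝ) + 1) * s k)) := by
  classical
  set m := Fintype.card ι with hm
  have hU : ∀ s : ℕ → ℝ, (∀ k, 0 ≤ s k) → unitExpLaw ι {x | ∀ k < m, s k < spacing x k} =
      ∑ τ : Fin m ≃ ι, unitExpLaw ι (gapCone τ s) := by
    intro s hs
    have h1 : ({x | ∀ k < m, s k < spacing x k} : Set (ι → ℝ)) =ᵐ[unitExpLaw ι]
        (⋃ τ ∈ (Finset.univ : Finset (Fin m ≃ ι)), gapCone τ s : Set (ι → ℝ)) := by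
      filter_upwards [ae_injective_unitExpLaw, ae_pos_unitExpLaw] with x hx h0
      have hmem : ∀ τ : Fin m ≃ ι, (∀ k, descRank x (τ k) = k) →
          (x ∈ gapCone τ s ↔ ∀ k < m, s k < spacing x k) := by
        intro τ hτ
        simp only [gapCone, Set.mem_ofPred_eq, spacing, orderStat_eq_enumCoord τ hx hτ]
        exact forall₂_congr fun k _ => by rw [lt_sub_iff_add_lt, add_comm]
      apply propext
      change (∀ k < m, s k < spacing x k) ↔
        x ∈ (⋃ τ ∈ (Finset.univ : Finset (Fin m ≃ ι)), gapCone τ s : Set (ι → ℝ))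
      simp only [Finset.mem_univ, Set.iUnion_true, Set.mem_iUnion]
      constructor
      · intro h
        obtain ⟨τ, hτ⟩ := exists_enumeration hx
        exact ⟨τ, (hmem τ hτ).2 h⟩
      · rintro ⟨τ, h⟩
        exact (hmem τ (descRank_of_mem_gapCone τ hs h)).1 h
    rw [measure_congr h1, measure_biUnion_finset _ fun τ _ => measurableSet_gapCone τ]
    intro τ _ τ' _ hne
    refine Set.disjoint_left.2 fun x h h' => hne (Equiv.ext fun k => ?_)
    apply descRank_injective (injective_of_mem_gapCone τ hs h)
    rw [descRank_of_mem_gapCone τ hs h, descRank_of_mem_gapCone τ' hs h']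
  have h0 : unitExpLaw ι {x | ∀ k < m, (0 : ℕ → ℝ) k < spacing x k} = 1 := by
    rw [← prob_compl_eq_zero_iff₀, ← mem_ae_iff]
    · filter_upwards [ae_injective_unitExpLaw, ae_pos_unitExpLaw] with x hx h0 k hk
      exact spacing_pos hx h0 hk
    · simp only [Set.ofPred_forall]
      exact (MeasurableSet.iInter fun k => MeasurableSet.iInter fun _ =>
        measurableSet_lt measurable_const (measurable_spacing k)).nullMeasurableSet
  rw [hU s hs]
  simp_rw [unitExpLaw_gapCone _ hs]
  rw [← Finset.mul_sum, ← hU 0 fun _ => le_rfl, h0, mul_one]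

/-- Rényi's representation: the normalized spacings of independent unit exponential variables
are independent and exponential. -/
theorem map_spacing_unitExpLaw {r : ℕ} (hr : r ≤ Fintype.card ι) :
    (unitExpLaw ι).map (fun x (i : Fin r) => spacing x i) = expLaw r := by
  have hpos : ∀ i : Fin r, (0 : ℝ) < (i : ℝ) + 1 := fun i => by positivity
  have hprob : ∀ i : Fin r, IsProbabilityMeasure (expMeasure ((i : ℝ) + 1)) :=
    fun i => isProbabilityMeasure_expMeasure (hpos i)
  have hmeas : Measurable fun (x : ι → ℝ) (i : Fin r) => spacing x i :=
    measurable_pi_lambda _ fun i => measurable_spacing i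
  symm
  -- The half-lines `(a, ∞)` form a generating π-system, so it is enough to compare joint survival
  -- functions.
  refine Measure.pi_eq_generateFrom (C := fun _ => Set.range Set.Ioi)
    (fun i => ?_) (fun i => isPiSystem_Ioi) (fun i => ?_) fun S hS => ?_
  · rw [← borel_eq_generateFrom_Ioi, BorelSpace.measurable_eq (α := ℝ)]
  · refine ⟨fun N => Set.Ioi (-(N : ℝ)), fun N => ⟨_, rfl⟩, fun N => measure_lt_top _ _, ?_⟩
    refine Set.eq_univ_of_forall fun x => ?_
    obtain ⟨N, hN⟩ := exists_nat_gt (-x)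
    exact Set.mem_iUnion.2 ⟨N, by simp; linarith⟩
  · choose a ha using hS
    obtain rfl : S = fun i => Set.Ioi (a i) := funext fun i => (ha i).symm
    -- Spacings are almost surely positive, so negative thresholds may be raised to zero, and the
    -- spacings beyond the first `r` may be given threshold zero without changing the probability.
    let s : ℕ → ℝ := fun k => if h : k < r then max (a ⟨k, h⟩) 0 else 0
    have hs : ∀ k, 0 ≤ s k := by
      intro k
      simp only [s]
      split_ifs <;> simp
    rw [Measure.map_apply hmeas (MeasurableSet.univ_pi fun i => measurableSet_Ioi)]
    have hcongr : ((fun (x : ι → ℝ) (i : Fin r) => spacing x i) ⁻¹'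
        Set.univ.pi fun i => Set.Ioi (a i) : Set (ι → ℝ)) =ᵐ[unitExpLaw ι]
        ({x | ∀ k < Fintype.card ι, s k < spacing x k} : Set (ι → ℝ)) := by
      filter_upwards [ae_injective_unitExpLaw, ae_pos_unitExpLaw] with x hx h0
      apply propext
      change (_ ∈ Set.univ.pi _) ↔ ∀ k < Fintype.card ι, s k < spacing x k
      simp only [Set.mem_univ_pi, Set.mem_Ioi]
      constructor
      · intro h k hk
        simp only [s]
        split_ifs with hkr
        · exact max_lt (h ⟨k, hkr⟩) (spacing_pos hx h0 hk)
        · exact spacing_pos hx h0 hk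
      · intro h i
        have := h i (i.2.trans_le hr)
        simp only [s, i.2, dif_pos] at this
        exact (le_max_left _ _).trans_lt this
    rw [measure_congr hcongr, unitExpLaw_spacing hs]
    have hprod : ∀ i : Fin r, expMeasure ((i : ℝ) + 1) (Set.Ioi (a i)) =
        ENNReal.ofReal (Real.exp (-(((i : ℕ) : ℝ) + 1) * s i)) := by
      intro i
      simp only [s, i.2, dif_pos]
      rcases le_total (a i) 0 with h | h
      · rw [expMeasure_Ioi_of_nonpos (hpos i) h, max_eq_right h]
        simp
      · rw [expMeasure_Ioi (hpos i) h, max_eq_left h, neg_mul]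
    simp_rw [hprod]
    rw [← ENNReal.ofReal_prod_of_nonneg fun i _ => (Real.exp_pos _).le, ← Real.exp_sum,
      Fin.sum_univ_eq_sum_range (fun k : ℕ => -((k : ℝ) + 1) * s k)]
    congr 2
    rw [← Finset.sum_neg_distrib]
    symm
    refine Finset.sum_subset_zero_on_sdiff (Finset.range_mono hr) (fun k hk => ?_)
      fun k _ => by ring
    have : ¬ k < r := by simpa using (Finset.mem_sdiff.1 hk).2
    simp [s, this]

end Renyi

/-! ### The two-sided normal tail -/

/-- The reciprocal hazard rate of the standard normal distribution,
as the integral `∫₀^∞ exp (-t u - u² / 2) du`. -/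
def millsRatio (t : ℝ) : ℝ := ∫ u in Set.Ioi (0 : ℝ), Real.exp (-(t * u) - u ^ 2 / 2)

lemma integrableOn_millsRatio {t : ℝ} (ht : 0 ≤ t) :
    IntegrableOn (fun u : ℝ => Real.exp (-(t * u) - u ^ 2 / 2)) (Set.Ioi 0) := by
  refine Integrable.mono' (integrable_exp_neg_mul_sq (b := 1 / 2) (by norm_num)).integrableOn
    (by fun_prop) ?_
  filter_upwards [ae_restrict_mem measurableSet_Ioi] with u hu
  rw [Real.norm_eq_abs, Real.abs_exp]
  exact Real.exp_le_exp.2 (by nlinarith [mul_nonneg ht (le_of_lt hu)])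

lemma millsRatio_pos {t : ℝ} (ht : 0 ≤ t) : 0 < millsRatio t :=
  (setIntegral_pos_iff_support_of_nonneg_ae (ae_of_all _ fun u => (Real.exp_pos _).le)
    (integrableOn_millsRatio ht)).2 (by
      have : Function.support (fun u : ℝ => Real.exp (-(t * u) - u ^ 2 / 2)) = Set.univ :=
        Set.eq_univ_of_forall fun u => (Real.exp_pos _).ne'
      rw [this]
      simp)

lemma millsRatio_anti {a b : ℝ} (hb : 0 ≤ b) (hab : b ≤ a) : millsRatio a ≤ millsRatio b :=
  setIntegral_mono_on (integrableOn_millsRatio (hb.trans hab)) (integrableOn_millsRatio hb)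
    measurableSet_Ioi fun u hu => Real.exp_le_exp.2 (by
      have := mul_le_mul_of_nonneg_right hab (le_of_lt (Set.mem_Ioi.1 hu))
      linarith)

/-- Substituting `u ↦ (a / b) u` writes `b * millsRatio b` as `a` times the integral defining
`millsRatio a`, with the quadratic term in the exponent multiplied by `(a / b)² ≥ 1`. -/
lemma mul_millsRatio_mono {a b : ℝ} (hb : 0 < b) (hab : b ≤ a) :
    b * millsRatio b ≤ a * millsRatio a := by
  have ha : 0 < a := hb.trans_le hab
  have hsub := integral_comp_mul_left_Ioi'
    (fun u : ℝ => Real.exp (-(b * u) - u ^ 2 / 2)) 0 (div_pos ha hb)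
  rw [mul_zero, smul_eq_mul] at hsub
  have hI := (integrableOn_Ioi_comp_mul_left_iff
    (fun u : ℝ => Real.exp (-(b * u) - u ^ 2 / 2)) 0 (div_pos ha hb)).2
      (by rw [mul_zero]; exact integrableOn_millsRatio hb.le)
  have h1 : 1 ≤ a / b := (one_le_div hb).2 hab
  rw [millsRatio, ← hsub, ← mul_assoc, mul_div_cancel₀ _ hb.ne']
  refine mul_le_mul_of_nonneg_left ?_ ha.le
  refine setIntegral_mono_on hI (integrableOn_millsRatio ha.le) measurableSet_Ioi fun u _ => ?_
  refine Real.exp_le_exp.2 ?_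
  have h2 : b * (a / b * u) = a * u := by field_simp
  have h3 : 1 * u ^ 2 ≤ (a / b) ^ 2 * u ^ 2 :=
    mul_le_mul_of_nonneg_right (one_le_pow₀ h1) (sq_nonneg u)
  rw [h2, mul_pow]
  linarith

lemma continuousOn_millsRatio : ContinuousOn millsRatio (Set.Ici 0) := by
  refine continuousOn_of_dominated (bound := fun u => Real.exp (-(1 / 2) * u ^ 2))
    (fun t _ => by fun_prop) (fun t ht => ?_)
    (integrable_exp_neg_mul_sq (b := 1 / 2) (by norm_num)).integrableOn
    (ae_of_all _ fun u => by fun_prop)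
  filter_upwards [ae_restrict_mem measurableSet_Ioi] with u hu
  rw [Real.norm_eq_abs, Real.abs_exp]
  exact Real.exp_le_exp.2 (by nlinarith [mul_nonneg (Set.mem_Ici.1 ht) (le_of_lt hu)])

/-- The tail `ℙ(|Z| > t)` of a standard normal variable `Z`. -/
def normalTail (t : ℝ) : ℝ := (gaussianReal 0 1).real {z | t < |z|}

/-- Shift the integral by `t` and factor `exp (-t² / 2)` out of the density. -/
lemma gaussianReal_Ioi (t : ℝ) : (gaussianReal 0 1).real (Set.Ioi t) =
    (√(2 * Real.pi))⁻¹ * Real.exp (-t ^ 2 / 2) * millsRatio t := by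
  rw [measureReal_def, gaussianReal_apply_eq_integral _ one_ne_zero, ENNReal.toReal_ofReal
    (integral_nonneg fun x => gaussianPDFReal_nonneg _ _ _), millsRatio,
    ← integral_const_mul, ← integral_indicator measurableSet_Ioi,
    ← integral_indicator measurableSet_Ioi,
    ← integral_add_right_eq_self _ t]
  congr 1
  funext x
  by_cases hx : 0 < x
  · rw [Set.indicator_of_mem (by simpa using hx), Set.indicator_of_mem (by simpa using hx),
      gaussianPDFReal_def, mul_assoc (√(2 * Real.pi))⁻¹, ← Real.exp_add]
    simp only [NNReal.coe_one, mul_one, sub_zero]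
    congr 2
    ring
  · rw [Set.indicator_of_notMem (by simpa using hx), Set.indicator_of_notMem (by simpa using hx)]

lemma normalTail_eq {t : ℝ} (ht : 0 ≤ t) :
    normalTail t = 2 * (√(2 * Real.pi))⁻¹ * Real.exp (-t ^ 2 / 2) * millsRatio t := by
  have hset : {z : ℝ | t < |z|} = Set.Ioi t ∪ (fun z => -z) ⁻¹' Set.Ioi t := by
    ext z
    simp [lt_abs, lt_neg]
  have hneg : (gaussianReal 0 1).real ((fun z => -z) ⁻¹' Set.Ioi t) =
      (gaussianReal 0 1).real (Set.Ioi t) := by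
    rw [← map_measureReal_apply measurable_neg measurableSet_Ioi, gaussianReal_map_neg, neg_zero]
  rw [normalTail, hset, measureReal_union _ (measurable_neg measurableSet_Ioi), hneg,
    gaussianReal_Ioi]
  · ring
  · refine Set.disjoint_left.2 fun z hz hz' => ?_
    simp only [Set.mem_preimage, Set.mem_Ioi] at hz hz'
    linarith

lemma normalTail_pos {t : ℝ} (ht : 0 ≤ t) : 0 < normalTail t := by
  rw [normalTail_eq ht]
  have := millsRatio_pos ht
  positivity

lemma antitone_normalTail : Antitone normalTail := fun _ _ hst =>
  measureReal_mono fun _ hz => lt_of_le_of_lt hst hz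

lemma normalTail_zero : normalTail 0 = 1 := by
  have h : {z : ℝ | 0 < |z|} = {0}ᶜ := by
    ext z
    simp
  have := nullSingletonClass_gaussianReal (μ := 0) (v := 1) one_ne_zero
  rw [normalTail, h, probReal_compl_eq_one_sub (measurableSet_singleton 0)]
  simp [measureReal_def]

/-- The cumulative hazard function of the absolute value of a standard normal variable. -/
def cumHazard (t : ℝ) : ℝ := -Real.log (normalTail t)

lemma exp_neg_cumHazard {t : ℝ} (ht : 0 ≤ t) : Real.exp (-cumHazard t) = normalTail t := by
  rw [cumHazard, neg_neg, Real.exp_log (normalTail_pos ht)]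

lemma cumHazard_zero : cumHazard 0 = 0 := by simp [cumHazard, normalTail_zero]

lemma cumHazard_sub {a b : ℝ} (ha : 0 ≤ a) (hb : 0 ≤ b) :
    cumHazard a - cumHazard b =
      (a ^ 2 - b ^ 2) / 2 + (Real.log (millsRatio b) - Real.log (millsRatio a)) := by
  have hc : (2 * (√(2 * Real.pi))⁻¹) ≠ 0 := by positivity
  have h : ∀ t, 0 ≤ t → Real.log (normalTail t) =
      Real.log (2 * (√(2 * Real.pi))⁻¹) + -t ^ 2 / 2 + Real.log (millsRatio t) := by
    intro t ht
    rw [normalTail_eq ht, Real.log_mul (mul_ne_zero hc (Real.exp_pos _).ne')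
      (millsRatio_pos ht).ne', Real.log_mul hc (Real.exp_pos _).ne', Real.log_exp]
  rw [cumHazard, cumHazard, h a ha, h b hb]
  ring

/-- Together with `cumHazard_sub_le` this says that the hazard at `t` lies between `t` and `t + 1 /
t`, in integrated form. The two bounds come from the monotonicity of `millsRatio` and of `t *
millsRatio t`. -/
lemma le_cumHazard_sub {a b : ℝ} (hb : 0 ≤ b) (hab : b ≤ a) :
    (a ^ 2 - b ^ 2) / 2 ≤ cumHazard a - cumHazard b := by
  rw [cumHazard_sub (hb.trans hab) hb]
  have := Real.log_le_log (millsRatio_pos (hb.trans hab)) (millsRatio_anti hb hab)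
  linarith

lemma cumHazard_sub_le {a b : ℝ} (hb : 0 < b) (hab : b ≤ a) :
    cumHazard a - cumHazard b ≤ (a ^ 2 - b ^ 2) / 2 + Real.log (a / b) := by
  have ha : 0 < a := hb.trans_le hab
  rw [cumHazard_sub ha.le hb.le, Real.log_div ha.ne' hb.ne']
  have h := Real.log_le_log (mul_pos hb (millsRatio_pos hb.le)) (mul_millsRatio_mono hb hab)
  rw [Real.log_mul hb.ne' (millsRatio_pos hb.le).ne',
    Real.log_mul ha.ne' (millsRatio_pos ha.le).ne'] at h
  linarith

lemma strictMonoOn_cumHazard : StrictMonoOn cumHazard (Set.Ici 0) := by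
  intro b hb a ha hab
  have h1 := le_cumHazard_sub hb hab.le
  have h2 : b ^ 2 < a ^ 2 := pow_lt_pow_left₀ hab hb two_ne_zero
  linarith

lemma sq_div_two_le_cumHazard {t : ℝ} (ht : 0 ≤ t) : t ^ 2 / 2 ≤ cumHazard t := by
  have := le_cumHazard_sub le_rfl ht
  rw [cumHazard_zero] at this
  linarith

lemma normalTail_le {t : ℝ} (ht : 0 ≤ t) : normalTail t ≤ Real.exp (-t ^ 2 / 2) := by
  rw [← exp_neg_cumHazard ht]
  exact Real.exp_le_exp.2 (by linarith [sq_div_two_le_cumHazard ht])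

/-- The spacing `a (a - b)` is close to the corresponding increment of the cumulative hazard. -/
lemma abs_mul_sub_sub_cumHazard_le {a b : ℝ} (hb : 0 < b) (hab : b ≤ a) :
    |a * (a - b) - (cumHazard a - cumHazard b)| ≤
      ((cumHazard a - cumHazard b) ^ 2 + (cumHazard a - cumHazard b)) / b ^ 2 := by
  set D := cumHazard a - cumHazard b with hD
  have ha : 0 < a := hb.trans_le hab
  have h1 : (a ^ 2 - b ^ 2) / 2 ≤ D := le_cumHazard_sub hb.le hab
  have h2 : D ≤ (a ^ 2 - b ^ 2) / 2 + Real.log (a / b) := cumHazard_sub_le hb hab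
  have h3 : (a - b) * b ≤ D := by nlinarith
  have h4 : a - b ≤ D / b := (le_div_iff₀ hb).2 h3
  have h5 : Real.log (a / b) ≤ D / b ^ 2 := by
    have h6 := Real.log_le_sub_one_of_pos (div_pos ha hb)
    have h7 : a / b - 1 = (a - b) / b := by field_simp
    have h8 : (a - b) / b ≤ D / b / b := by gcongr
    rw [div_div, ← pow_two] at h8
    linarith
  have hD0 : 0 ≤ D := le_trans (by nlinarith) h1
  have h9 : (a - b) ^ 2 ≤ D ^ 2 / b ^ 2 := by
    rw [← div_pow]
    exact pow_le_pow_left₀ (by linarith) h4 2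
  have h10 : 0 ≤ D / b ^ 2 := by positivity
  have h11 : 0 ≤ D ^ 2 / b ^ 2 := by positivity
  rw [add_div, abs_le]
  -- With `a (a - b) = (a² - b²) / 2 + (a - b)² / 2`, the lower bound costs `log (a / b) ≤ D / b²`
  -- and the upper bound costs `(a - b)² / 2 ≤ D² / (2 b²)`.
  constructor <;> nlinarith [sq_nonneg (a - b)]

/-- Intermediate value theorem on `[0, √(2 s)]`; the right endpoint is large enough because `t² / 2
≤ cumHazard t`. -/
lemma exists_cumHazard_eq {s : ℝ} (hs : 0 ≤ s) : ∃ t, 0 ≤ t ∧ cumHazard t = s := by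
  have hcont : ContinuousOn cumHazard (Set.Ici 0) := by
    have h : ContinuousOn (fun t => cumHazard t - cumHazard 0) (Set.Ici 0) := by
      have h' : ContinuousOn (fun t => (t ^ 2 - 0 ^ 2) / 2 +
          (Real.log (millsRatio 0) - Real.log (millsRatio t))) (Set.Ici 0) := by
        refine ContinuousOn.add (by fun_prop) (continuousOn_const.sub ?_)
        exact continuousOn_millsRatio.log fun t ht => (millsRatio_pos ht).ne'
      exact h'.congr fun t ht => cumHazard_sub ht le_rfl
    simpa [cumHazard_zero] using h
  set T := √(2 * s)
  have hT : s ≤ cumHazard T := by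
    have := sq_div_two_le_cumHazard (Real.sqrt_nonneg (2 * s))
    rw [Real.sq_sqrt (by linarith)] at this
    linarith
  obtain ⟨t, ht, hts⟩ := intermediate_value_Icc (Real.sqrt_nonneg (2 * s))
    (hcont.mono Set.Icc_subset_Ici_self) (⟨by rwa [cumHazard_zero], hT⟩ : s ∈ Set.Icc _ _)
  exact ⟨t, ht.1, hts⟩

lemma measurable_cumHazard : Measurable cumHazard :=
  (Real.measurable_log.comp antitone_normalTail.measurable).neg

/-- The cumulative hazard transform of `|Z|` is a unit exponential variable. -/
lemma map_cumHazard_abs :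
    (gaussianReal 0 1).map (fun z => cumHazard |z|) = expMeasure 1 := by
  have hm : Measurable fun z : ℝ => cumHazard |z| := measurable_cumHazard.comp measurable_abs
  have := Measure.isProbabilityMeasure_map (μ := gaussianReal 0 1) hm.aemeasurable
  have h0 : ∀ z : ℝ, 0 ≤ cumHazard |z| := fun z =>
    (by positivity : (0 : ℝ) ≤ |z| ^ 2 / 2).trans (sq_div_two_le_cumHazard (abs_nonneg z))
  refine Measure.eq_of_cdf _ _ (StieltjesFunction.ext fun s => ?_)
  rw [cdf_expMeasure_eq one_pos, cdf_eq_real, map_measureReal_apply hm measurableSet_Iic]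
  split_ifs with hs
  · obtain ⟨t, ht, rfl⟩ := exists_cumHazard_eq hs
    have hset : (fun z : ℝ => cumHazard |z|) ⁻¹' Set.Iic (cumHazard t) = {z | t < |z|}ᶜ := by
      ext z
      simp only [Set.mem_preimage, Set.mem_Iic, Set.mem_compl_iff, Set.mem_ofPred_eq, not_lt]
      exact strictMonoOn_cumHazard.le_iff_le (abs_nonneg z) ht
    rw [hset, probReal_compl_eq_one_sub (measurableSet_lt measurable_const measurable_abs),
      one_mul, exp_neg_cumHazard ht]
    rfl
  · have hset : (fun z : ℝ => cumHazard |z|) ⁻¹' Set.Iic s = ∅ := by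
      ext z
      simp only [Set.mem_preimage, Set.mem_Iic, Set.mem_empty_iff_false, iff_false, not_le]
      exact (not_le.1 hs).trans_le (h0 z)
    rw [hset, measureReal_empty]

/-! ### Separation of the signal variables -/

section Separation

variable {Ω : Type*} [MeasurableSpace Ω] {P : Measure Ω}

lemma measure_lt_abs_eq {Z : Ω → ℝ} (hZ : HasLaw Z (gaussianReal 0 1) P) (t : ℝ) :
    P {ω | t < |Z ω|} = ENNReal.ofReal (normalTail t) := by
  rw [hZ.measure_eq (p := fun z => t < |z|) (measurableSet_lt measurable_const measurable_abs),
    normalTail, ofReal_measureReal]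

variable {n p : ℕ} {X : Matrix (Fin n) (Fin p) ℝ} {β : Fin p → ℝ} {σ : ℝ} {y : Ω → Fin n → ℝ}

/-- The event that every score in the support exceeds every score outside of it. -/
def separatedEvent (X : Matrix (Fin n) (Fin p) ℝ) (β : Fin p → ℝ) (y : Ω → Fin n → ℝ) : Set Ω :=
  {ω | (⨆ j ∉ support β, ((|(Xᵀ *ᵥ y ω) j| : ℝ) : EReal))
    < ⨅ j ∈ support β, ((|(Xᵀ *ᵥ y ω) j| : ℝ) : EReal)}

omit [MeasurableSpace Ω] in
lemma abs_score_lt_of_mem_separatedEvent {ω : Ω} (h : ω ∈ separatedEvent X β y) {i j : Fin p}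
    (hi : i ∈ support β) (hj : j ∉ support β) : |(Xᵀ *ᵥ y ω) j| < |(Xᵀ *ᵥ y ω) i| := by
  have h1 := le_iSup₂ (f := fun j (_ : j ∉ support β) =>
    ((|(Xᵀ *ᵥ y ω) j| : ℝ) : EReal)) j hj
  have h2 := iInf₂_le (f := fun j (_ : j ∈ support β) =>
    ((|(Xᵀ *ᵥ y ω) j| : ℝ) : EReal)) i hi
  exact EReal.coe_lt_coe_iff.1 (h1.trans_lt (lt_of_lt_of_le h h2))

lemma eq_zero_of_notMem_support {ι : Type*} [Fintype ι] {b : ι → ℝ} {j : ι}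
    (hj : j ∉ support b) : b j = 0 := by
  simpa [support] using hj

omit [MeasurableSpace Ω] in
-- The null scores stay below `σ (t + a)`. A signal loses at most `σ a` of its margin `3 σ a`, so it
-- stays above `σ (t + 2 a)`. The two intermediate levels also handle empty index sets.
lemma mem_separatedEvent_of_abs_standardScore_le (hσ : 0 < σ) {a t : ℝ} (ha : 0 < a)
    (hβ : ∀ j ∈ support β, σ * t + 3 * σ * a < |β j|) {ω : Ω}
    (h1 : ∀ j ∈ support β, |standardScore X β σ y j ω| ≤ a)
    (h2 : ∀ j ∉ support β, |standardScore X β σ y j ω| ≤ t + a) :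
    ω ∈ separatedEvent X β y := by
  have hsup : (⨆ j ∉ support β, ((|(Xᵀ *ᵥ y ω) j| : ℝ) : EReal))
      ≤ ((σ * (t + a) : ℝ) : EReal) := by
    refine iSup₂_le fun j hj => EReal.coe_le_coe_iff.2 ?_
    rw [score_eq (β := β) hσ, eq_zero_of_notMem_support hj, zero_add, abs_mul, abs_of_pos hσ]
    exact mul_le_mul_of_nonneg_left (h2 j hj) hσ.le
  have hinf : ((σ * (t + 2 * a) : ℝ) : EReal)
      ≤ ⨅ j ∈ support β, ((|(Xᵀ *ᵥ y ω) j| : ℝ) : EReal) := by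
    refine le_iInf₂ fun j hj => EReal.coe_le_coe_iff.2 ?_
    rw [score_eq (β := β) hσ]
    have h3 := abs_sub_abs_le_abs_sub (β j) (-(σ * standardScore X β σ y j ω))
    rw [abs_neg, abs_mul, abs_of_pos hσ, sub_neg_eq_add] at h3
    have h4 := mul_le_mul_of_nonneg_left (h1 j hj) hσ.le
    have h5 := hβ j hj
    linarith
  refine hsup.trans_lt (lt_of_lt_of_le (EReal.coe_lt_coe_iff.2 ?_) hinf)
  nlinarith [mul_pos hσ ha]

variable [IsProbabilityMeasure P]

/-- Union bound: each signal costs `exp (-a² / 2)`, and all the null variables together cost one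
more such term, since the level `√(2 log p)` supplies the factor `1 / p`. -/
lemma measure_compl_separatedEvent_le (hσ : 0 < σ) (hX : Xᵀ * X = 1)
    (hy : IsGaussianLinearModel P X β σ y) (hp : 1 ≤ p) {a : ℝ} (ha : 0 < a)
    (hβ : ∀ j ∈ support β, σ * √(2 * Real.log p) + 3 * σ * a < |β j|) :
    P (separatedEvent X β y)ᶜ ≤
      ENNReal.ofReal (((support β).card + 1) * Real.exp (-a ^ 2 / 2)) := by
  set t := √(2 * Real.log p) with ht
  have ht0 : 0 ≤ t := Real.sqrt_nonneg _
  have hp0 : (1 : ℝ) ≤ p := by exact_mod_cast hp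
  have hlog : 0 ≤ Real.log p := Real.log_nonneg hp0
  have hsub : (separatedEvent X β y)ᶜ ⊆
      (⋃ j ∈ support β, {ω | a < |standardScore X β σ y j ω|}) ∪
        ⋃ j ∈ (support β)ᶜ, {ω | t + a < |standardScore X β σ y j ω|} := by
    intro ω hω
    by_contra h
    simp only [Set.mem_union, Set.mem_iUnion, Set.mem_ofPred_eq, not_or, not_exists, not_lt,
      Finset.mem_compl] at h
    exact hω (mem_separatedEvent_of_abs_standardScore_le hσ ha hβ h.1 h.2)
  have hZ := fun j => hy.hasLaw_standardScore hσ hX j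
  have hE : 0 ≤ Real.exp (-a ^ 2 / 2) := (Real.exp_pos _).le
  refine (measure_mono hsub).trans ((measure_union_le _ _).trans ?_)
  rw [add_mul, ENNReal.ofReal_add (by positivity) (by positivity)]
  refine add_le_add ?_ ?_
  · refine (measure_biUnion_finset_le _ _).trans ?_
    simp_rw [measure_lt_abs_eq (hZ _)]
    rw [Finset.sum_const, nsmul_eq_mul, ENNReal.ofReal_mul (by positivity),
      ENNReal.ofReal_natCast]
    gcongr
    exact normalTail_le ha.le
  · refine (measure_biUnion_finset_le _ _).trans ?_
    simp_rw [measure_lt_abs_eq (hZ _)]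
    rw [Finset.sum_const, nsmul_eq_mul, ← ENNReal.ofReal_natCast,
      ← ENNReal.ofReal_mul (by positivity)]
    refine ENNReal.ofReal_le_ofReal ?_
    have hcard : (((support β)ᶜ.card : ℕ) : ℝ) ≤ p := by
      have := Finset.card_le_univ (support β)ᶜ
      rw [Fintype.card_fin] at this
      exact_mod_cast this
    have htail : normalTail (t + a) ≤ (p : ℝ)⁻¹ * Real.exp (-a ^ 2 / 2) := by
      refine (normalTail_le (by positivity)).trans ?_
      rw [← Real.exp_log (by positivity : (0 : ℝ) < (p : ℝ)⁻¹), ← Real.exp_add]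
      refine Real.exp_le_exp.2 ?_
      rw [Real.log_inv]
      have : t ^ 2 = 2 * Real.log p := Real.sq_sqrt (by positivity)
      -- `(t + a)² / 2 ≥ t² / 2 + a² / 2 = log p + a² / 2`, dropping the cross term `t a ≥ 0`.
      nlinarith [mul_nonneg ht0 ha.le]
    calc _ ≤ (p : ℝ) * ((p : ℝ)⁻¹ * Real.exp (-a ^ 2 / 2)) :=
          mul_le_mul hcard htail (normalTail_pos (by positivity)).le (by positivity)
      _ = 1 * Real.exp (-a ^ 2 / 2) := by field_simp

end Separation

lemma lt_abs_of_lt_iInf_sub {p : ℕ} {β : Fin p → ℝ} {c d : ℝ}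
    (h : (d : EReal) < (⨅ j ∈ support β, ((|β j| : ℝ) : EReal)) - (c : EReal)) {j : Fin p}
    (hj : j ∈ support β) : c + d < |β j| := by
  have h1 : (⨅ j ∈ support β, ((|β j| : ℝ) : EReal)) ≤ ((|β j| : ℝ) : EReal) := iInf₂_le j hj
  have h2 : (d : EReal) < ((|β j| - c : ℝ) : EReal) := by
    rw [EReal.coe_sub]
    exact h.trans_le (EReal.sub_le_sub h1 le_rfl)
  linarith [EReal.coe_lt_coe_iff.1 h2]

lemma tendsto_ofReal_mul_exp_neg_sq (c : ℝ) :
    Tendsto (fun a : ℝ => ENNReal.ofReal (c * Real.exp (-a ^ 2 / 2))) atTop (𝓝 0) := by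
  have h1 : Tendsto (fun a : ℝ => -a ^ 2 / 2) atTop atBot := by
    have : Tendsto (fun a : ℝ => a ^ 2 / 2) atTop atTop :=
      (tendsto_pow_atTop two_ne_zero).atTop_div_const two_pos
    refine (tendsto_neg_atTop_atBot.comp this).congr fun a => ?_
    simp [neg_div]
  have h2 := ENNReal.tendsto_ofReal ((Real.tendsto_exp_atBot.comp h1).const_mul c)
  simpa using h2

lemma tendsto_measure_compl_separatedEvent
    {Ω : ℕ → Type*} [∀ p, MeasurableSpace (Ω p)]
    {P : (p : ℕ) → Measure (Ω p)} [∀ p, IsProbabilityMeasure (P p)]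
    {n : ℕ → ℕ} {X : (p : ℕ) → Matrix (Fin (n p)) (Fin p) ℝ}
    (hX : ∀ p, (X p)ᵀ * X p = 1)
    {β : (p : ℕ) → Fin p → ℝ} {σ : ℝ} (hσ : 0 < σ)
    {y : (p : ℕ) → Ω p → Fin (n p) → ℝ}
    (hy : ∀ p, IsGaussianLinearModel (P p) (X p) (β p) σ (y p))
    {kstar : ℕ} (hk : ∀ᶠ p in atTop, (support (β p)).card = kstar)
    (hβ : Tendsto
      (fun p : ℕ => (⨅ j ∈ support (β p), ((|β p j| : ℝ) : EReal))
        - ((σ * √(2 * Real.log p) : ℝ) : EReal)) atTop (𝓝 ⊤)) :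
    Tendsto (fun p => P p (separatedEvent (X p) (β p) (y p))ᶜ) atTop (𝓝 0) := by
  rw [ENNReal.tendsto_nhds_zero]
  intro ε hε
  obtain ⟨a, haε, ha⟩ := (((ENNReal.tendsto_nhds_zero.1
    (tendsto_ofReal_mul_exp_neg_sq (kstar + 1))) ε hε).and (eventually_gt_atTop 0)).exists
  filter_upwards [hk, eventually_ge_atTop 1,
    hβ.eventually (lt_mem_nhds (EReal.coe_lt_top (3 * σ * a)))] with p hkp hp hβp
  refine (measure_compl_separatedEvent_le hσ (hX p) (hy p) hp ha
    fun j hj => lt_abs_of_lt_iInf_sub hβp hj).trans ?_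
  rwa [hkp]

lemma tendsto_measure_one_of_compl {Ω : ℕ → Type*} [∀ p, MeasurableSpace (Ω p)]
    {P : (p : ℕ) → Measure (Ω p)} [∀ p, IsProbabilityMeasure (P p)] {E : (p : ℕ) → Set (Ω p)}
    (h : Tendsto (fun p => P p (E p)ᶜ) atTop (𝓝 0)) :
    Tendsto (fun p => P p (E p)) atTop (𝓝 1) := by
  have h1 : Tendsto (fun p => 1 - P p (E p)ᶜ) atTop (𝓝 (1 - 0)) :=
    ENNReal.Tendsto.sub tendsto_const_nhds h (Or.inl ENNReal.one_ne_top)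
  rw [tsub_zero] at h1
  refine tendsto_of_tendsto_of_tendsto_of_le_of_le h1 tendsto_const_nhds (fun p => ?_)
    fun p => prob_le_one
  rw [tsub_le_iff_right, ← measure_univ (μ := P p), ← Set.union_compl_self (E p)]
  exact measure_union_le _ _

/-! ### Extreme order statistics of independent normal variables -/

section Extremes

variable {Ω ι : Type*} [MeasurableSpace Ω] {P : Measure Ω} [Fintype ι]
  {Z : ι → Ω → ℝ}

/-- At most two values of `W` are compatible with a given absolute value, and the normal law has no
atoms. -/
lemma measure_preimage_singleton_affine_abs {W : Ω → ℝ} (hW : HasLaw W (gaussianReal 0 1) P)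
    {σ : ℝ} (hσ : 0 < σ) (b t : ℝ) : P ((fun ω => |b + σ * W ω|) ⁻¹' {t}) = 0 := by
  have hfin : ({(t - b) / σ, (-t - b) / σ} : Set ℝ).Finite := Set.toFinite _
  have hnull : gaussianReal 0 1 ({(t - b) / σ, (-t - b) / σ} : Set ℝ) = 0 :=
    gaussianReal_absolutelyContinuous 0 one_ne_zero (hfin.measure_zero _)
  have hlaw : P (W ⁻¹' {(t - b) / σ, (-t - b) / σ}) = 0 := by
    rw [← Measure.map_apply_of_aemeasurable hW.aemeasurable hfin.measurableSet, hW.map_eq, hnull]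
  refine measure_mono_null (fun ω hω => ?_) hlaw
  rw [Set.mem_preimage, Set.mem_singleton_iff] at hω
  rw [Set.mem_preimage, Set.mem_insert_iff, Set.mem_singleton_iff, eq_div_iff hσ.ne',
    eq_div_iff hσ.ne']
  rcases abs_choice (b + σ * W ω) with h | h
  · left; linarith
  · right; linarith

/-- The spacings of the transformed absolute values of independent normal variables are
independent exponential variables. -/
lemma hasLaw_spacing_cumHazard (hZ : ∀ j, HasLaw (Z j) (gaussianReal 0 1) P)
    (hind : iIndepFun Z P) {r : ℕ} (hr : r ≤ Fintype.card ι) :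
    HasLaw (fun ω (i : Fin r) => spacing (fun j => cumHazard |Z j ω|) i) (expLaw r) P := by
  have hm : Measurable fun z : ℝ => cumHazard |z| := measurable_cumHazard.comp measurable_abs
  have hH : HasLaw (fun z : ℝ => cumHazard |z|) (expMeasure 1) (gaussianReal 0 1) :=
    ⟨hm.aemeasurable, map_cumHazard_abs⟩
  have hj : ∀ j, HasLaw (fun ω => cumHazard |Z j ω|) (expMeasure 1) P := fun j => hH.comp (hZ j)
  have hE : HasLaw (fun ω j => cumHazard |Z j ω|) (unitExpLaw ι) P :=
    iIndepFun.hasLaw_pi hj (hind.comp (fun _ z => cumHazard |z|) fun _ => hm)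
  have hs : HasLaw (fun (x : ι → ℝ) (i : Fin r) => spacing x i) (expLaw r) (unitExpLaw ι) :=
    ⟨(measurable_pi_lambda _ fun i : Fin r => measurable_spacing (i : ℕ)).aemeasurable,
      map_spacing_unitExpLaw hr⟩
  exact hs.comp hE

variable [IsProbabilityMeasure P]

lemma ae_injective_and_pos_affine_abs (hZ : ∀ j, HasLaw (Z j) (gaussianReal 0 1) P)
    (hind : iIndepFun Z P) {σ : ℝ} (hσ : 0 < σ) (b : ι → ℝ) :
    ∀ᵐ ω ∂P, (Function.Injective fun j => |b j + σ * Z j ω|) ∧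
      ∀ j, 0 < |b j + σ * Z j ω| := by
  have h1 : ∀ᵐ ω ∂P, Function.Injective fun j => |b j + σ * Z j ω| := by
    refine ae_injective_of_iIndepFun (A := fun j ω => |b j + σ * Z j ω|) (fun j => ?_) ?_
      fun j t => measure_preimage_singleton_affine_abs (hZ j) hσ (b j) t
    · have := (hZ j).aemeasurable
      fun_prop
    · exact hind.comp (fun j z => |b j + σ * z|) fun j => by fun_prop
  have h2 : ∀ᵐ ω ∂P, ∀ j, 0 < |b j + σ * Z j ω| := by
    refine ae_all_iff.2 fun j => ?_
    filter_upwards [measure_eq_zero_iff_ae_notMem.1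
      (measure_preimage_singleton_affine_abs (hZ j) hσ (b j) 0)] with ω hω
    exact lt_of_le_of_ne (abs_nonneg _) fun h => hω h.symm
  exact h1.and h2

lemma ae_injective_and_pos_abs (hZ : ∀ j, HasLaw (Z j) (gaussianReal 0 1) P)
    (hind : iIndepFun Z P) :
    ∀ᵐ ω ∂P, (Function.Injective fun j => |Z j ω|) ∧ ∀ j, 0 < |Z j ω| := by
  simpa using ae_injective_and_pos_affine_abs hZ hind one_pos fun _ => 0

/-- If the order statistic of index `r` is at most `B`, then outside some set `W` of `r` indices all
`|Z j|` are at most `B`. Union bound over `W`, with the binomial coefficient bounded by a power. -/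
lemma measure_orderStat_abs_le (hZ : ∀ j, HasLaw (Z j) (gaussianReal 0 1) P)
    (hind : iIndepFun Z P) {r : ℕ} (hr : r < Fintype.card ι) (B : ℝ) :
    P {ω | orderStat (fun j => |Z j ω|) r ≤ B} ≤
      (Fintype.card ι : ENNReal) ^ r *
        ENNReal.ofReal (1 - normalTail B) ^ (Fintype.card ι - r) := by
  classical
  have hsub : ({ω | orderStat (fun j => |Z j ω|) r ≤ B} : Set Ω) ≤ᵐ[P]
      (⋃ W ∈ Finset.powersetCard r (Finset.univ : Finset ι),
        ⋂ j ∈ Wᶜ, Z j ⁻¹' {z | B < |z|}ᶜ : Set Ω) := by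
    filter_upwards [ae_injective_and_pos_abs hZ hind] with ω hω h
    change orderStat (fun j => |Z j ω|) r ≤ B at h
    change ω ∈ (⋃ W ∈ Finset.powersetCard r (Finset.univ : Finset ι),
        ⋂ j ∈ Wᶜ, Z j ⁻¹' {z | B < |z|}ᶜ : Set Ω)
    obtain ⟨i, hi⟩ := exists_descRank_eq hω.1 hr
    have hos := orderStat_descRank hω.1 i
    rw [hi] at hos
    rw [hos] at h
    simp only [Set.mem_iUnion, Set.mem_iInter, Finset.mem_powersetCard]
    refine ⟨Finset.univ.filter fun j => |Z i ω| < |Z j ω|, ⟨Finset.subset_univ _, hi⟩,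
      fun j hj => ?_⟩
    simp only [Finset.mem_compl, Finset.mem_filter, Finset.mem_univ, true_and, not_lt] at hj
    simpa using hj.trans h
  have hm : MeasurableSet {z : ℝ | B < |z|}ᶜ :=
    (measurableSet_lt measurable_const measurable_abs).compl
  have hone : ∀ j, P (Z j ⁻¹' {z | B < |z|}ᶜ) = ENNReal.ofReal (1 - normalTail B) := by
    intro j
    rw [← Measure.map_apply_of_aemeasurable (hZ j).aemeasurable hm, (hZ j).map_eq,
      ← ofReal_measureReal, probReal_compl_eq_one_sub
        (measurableSet_lt measurable_const measurable_abs)]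
    rfl
  refine (measure_mono_ae hsub).trans ((measure_biUnion_finset_le _ _).trans ?_)
  have hterm : ∀ W ∈ Finset.powersetCard r (Finset.univ : Finset ι),
      P (⋂ j ∈ Wᶜ, Z j ⁻¹' {z | B < |z|}ᶜ) =
        ENNReal.ofReal (1 - normalTail B) ^ (Fintype.card ι - r) := by
    intro W hW
    rw [hind.measure_inter_preimage_eq_mul Wᶜ fun _ _ => hm]
    simp_rw [hone]
    rw [Finset.prod_const, Finset.card_compl, (Finset.mem_powersetCard.1 hW).2]
  rw [Finset.sum_congr rfl hterm, Finset.sum_const, Finset.card_powersetCard, Finset.card_univ,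
    nsmul_eq_mul]
  gcongr
  exact_mod_cast Nat.choose_le_pow (Fintype.card ι) r

end Extremes

/-- Geometric decay beats polynomial growth; `q ≠ 0` permits division by `q ^ r`. -/
lemma tendsto_pow_mul_pow_sub {q : ENNReal} (hq : q < 1) (hq0 : q ≠ 0) (r : ℕ) :
    Tendsto (fun m : ℕ => (m : ENNReal) ^ r * q ^ (m - r)) atTop (𝓝 0) := by
  have hqt : q ≠ ⊤ := (hq.trans ENNReal.one_lt_top).ne
  have h1 : Tendsto (fun m : ℕ => (m : ℝ) ^ r * q.toReal ^ m) atTop (𝓝 0) :=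
    tendsto_pow_const_mul_const_pow_of_lt_one r ENNReal.toReal_nonneg
      (by rw [← ENNReal.toReal_one]; exact (ENNReal.toReal_lt_toReal hqt ENNReal.one_ne_top).2 hq)
  have h2 : Tendsto (fun m : ℕ => (m : ENNReal) ^ r * q ^ m) atTop (𝓝 0) := by
    have h3 := ENNReal.tendsto_ofReal h1
    rw [ENNReal.ofReal_zero] at h3
    refine h3.congr fun m => ?_
    rw [ENNReal.ofReal_mul (by positivity), ENNReal.ofReal_pow (by positivity),
      ENNReal.ofReal_pow ENNReal.toReal_nonneg, ENNReal.ofReal_natCast, ENNReal.ofReal_toReal hqt]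
  have h4 := ENNReal.Tendsto.mul_const (b := (q ^ r)⁻¹) h2
    (Or.inr (ENNReal.inv_ne_top.2 (pow_ne_zero r hq0)))
  rw [zero_mul] at h4
  refine h4.congr' ?_
  filter_upwards [eventually_ge_atTop r] with m hm
  have hpow : q ^ m = q ^ (m - r) * q ^ r := by rw [← pow_add, Nat.sub_add_cancel hm]
  rw [hpow, mul_assoc, mul_assoc, ENNReal.mul_inv_cancel (pow_ne_zero r hq0)
    (ENNReal.pow_ne_top hqt), mul_one]

/-! ### Convergence in distribution of the test statistics -/

/-- If `D p` eventually has law `ν` and `T p - D p` tends to zero in probability, then `T p`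
converges in distribution to `ν`. The underlying probability spaces may vary with `p`. -/
lemma tendstoInDistribution_of_hasLaw {E : Type*} [NormedAddCommGroup E]
    [SecondCountableTopology E] [MeasurableSpace E] [BorelSpace E]
    {Ω : ℕ → Type*} [∀ p, MeasurableSpace (Ω p)]
    {P : (p : ℕ) → Measure (Ω p)} [∀ p, IsProbabilityMeasure (P p)]
    {T D : (p : ℕ) → Ω p → E} {ν : Measure E} [IsProbabilityMeasure ν]
    (hT : ∀ p, AEMeasurable (T p) (P p)) (hD : ∀ᶠ p in atTop, HasLaw (D p) ν (P p))
    (hTD : ∀ ε > 0, Tendsto (fun p => P p {ω | ε ≤ ‖T p ω - D p ω‖}) atTop (𝓝 0)) :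
    TendstoInDistribution T atTop (id : E → E) P ν := by
  refine ⟨hT, aemeasurable_id, ?_⟩
  -- Bounded Lipschitz test functions suffice: where `T p` and `D p` are `ε`-close the integrals
  -- differ by at most `L ε`, and elsewhere by at most `M` times a vanishing probability.
  suffices ∀ (F : E → ℝ) (_ : ∃ C : ℝ, ∀ x y, dist (F x) (F y) ≤ C)
      (_ : ∃ L, LipschitzWith L F),
      Tendsto (fun p => ∫ x, F x ∂((P p).map (T p))) atTop (𝓝 (∫ x, F x ∂(ν.map id))) by
    exact tendsto_iff_forall_lipschitz_integral_tendsto.2 this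
  rintro F ⟨M, hM⟩ ⟨L, hL⟩
  have hF : Continuous F := hL.continuous
  have hM0 : 0 ≤ M := (dist_nonneg).trans (hM 0 0)
  rw [Metric.tendsto_atTop']
  intro δ hδ
  -- Chosen so that `L ε ≤ δ / 2`; the `+ 1` covers `L = 0`.
  have hε : 0 < δ / (2 * (L + 1)) := by positivity
  set ε := δ / (2 * (L + 1)) with hεdef
  have hsmall : ∀ᶠ p in atTop, M * (P p).real {ω | ε ≤ ‖T p ω - D p ω‖} < δ / 2 := by
    have h1 := ((ENNReal.tendsto_toReal ENNReal.zero_ne_top).comp (hTD ε hε)).const_mul M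
    rw [ENNReal.toReal_zero, mul_zero] at h1
    exact h1.eventually (gt_mem_nhds (half_pos hδ))
  obtain ⟨N, hN⟩ := eventually_atTop.1 (hsmall.and hD)
  refine ⟨N, fun p hp => ?_⟩
  obtain ⟨h1, h2⟩ := hN p hp.le
  have hTp := hT p
  have hDp := h2.aemeasurable
  rw [Measure.map_id, ← h2.map_eq, integral_map hTp hF.aestronglyMeasurable,
    integral_map hDp hF.aestronglyMeasurable, Real.dist_eq]
  have hint : ∀ G : Ω p → E, AEMeasurable G (P p) → Integrable (fun ω => F (G ω)) (P p) := by
    intro G hG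
    refine Integrable.of_bound (hF.measurable.comp_aemeasurable hG).aestronglyMeasurable
      (‖F 0‖ + M) (ae_of_all _ fun ω => ?_)
    have h3 := hM (G ω) 0
    rw [Real.dist_eq] at h3
    have h4 := abs_sub_abs_le_abs_sub (F (G ω)) (F 0)
    rw [Real.norm_eq_abs, Real.norm_eq_abs]
    linarith
  rw [← integral_sub (hint _ hTp) (hint _ hDp)]
  have hset : NullMeasurableSet {ω | ε ≤ ‖T p ω - D p ω‖} (P p) :=
    nullMeasurableSet_le aemeasurable_const (hTp.sub hDp).norm
  calc |∫ ω, F (T p ω) - F (D p ω) ∂(P p)|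
      ≤ ∫ ω, |F (T p ω) - F (D p ω)| ∂(P p) := abs_integral_le_integral_abs
    _ ≤ ∫ ω, (L * ε + Set.indicator {ω | ε ≤ ‖T p ω - D p ω‖} (fun _ => M) ω) ∂(P p) := by
        refine integral_mono ((hint _ hTp).sub (hint _ hDp)).abs
          ((integrable_const _).add ((integrable_const M).indicator₀ hset)) fun ω => ?_
        by_cases hω : ε ≤ ‖T p ω - D p ω‖
        · have h3 := hM (T p ω) (D p ω)
          rw [Real.dist_eq] at h3
          have h4 : 0 ≤ (L : ℝ) * ε := by positivity
          simp only [Set.indicator, Set.mem_ofPred_eq, hω, if_true]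
          linarith
        · have h3 := hL.dist_le_mul (T p ω) (D p ω)
          rw [Real.dist_eq, dist_eq_norm] at h3
          simp only [Set.indicator, Set.mem_ofPred_eq, hω, if_false, add_zero]
          exact h3.trans (mul_le_mul_of_nonneg_left (not_le.1 hω).le L.2)
    _ = L * ε + M * (P p).real {ω | ε ≤ ‖T p ω - D p ω‖} := by
        rw [integral_add (integrable_const _) ((integrable_const M).indicator₀ hset),
          integral_indicator₀ hset]
        simp [mul_comm]
    _ < δ := by
        have h3 : (L : ℝ) * ε ≤ δ / 2 := by
          rw [hεdef, ← mul_div_assoc, div_le_iff₀ (by positivity)]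
          nlinarith [L.2, hδ]
        linarith

/-- Every rate is at least one, so each coordinate has tail at most `exp (-K)`. -/
lemma expLaw_exists_lt_le {r : ℕ} {K : ℝ} (hK : 0 ≤ K) :
    expLaw r {x | ∃ i, K < x i} ≤ ENNReal.ofReal (r * Real.exp (-K)) := by
  have hprob : ∀ i : Fin r, IsProbabilityMeasure (expMeasure ((i : ℝ) + 1)) :=
    fun i => isProbabilityMeasure_expMeasure (by positivity)
  have hset : {x : Fin r → ℝ | ∃ i, K < x i} = ⋃ i, Function.eval i ⁻¹' Set.Ioi K := by
    ext x
    simp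
  have hi : ∀ i : Fin r, expLaw r (Function.eval i ⁻¹' Set.Ioi K) ≤
      ENNReal.ofReal (Real.exp (-K)) := by
    intro i
    have h := (measurePreserving_eval (fun i : Fin r => expMeasure ((i : ℝ) + 1)) i).measure_preimage
      (measurableSet_Ioi (a := K)).nullMeasurableSet
    rw [expLaw, h, expMeasure_Ioi (by positivity) hK]
    refine ENNReal.ofReal_le_ofReal (Real.exp_le_exp.2 ?_)
    have : 0 ≤ (i : ℝ) * K := by positivity
    linarith
  rw [hset]
  refine (measure_iUnion_fintype_le _ _).trans ((Finset.sum_le_sum fun i _ => hi i).trans ?_)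
  rw [Finset.sum_const, Finset.card_univ, Fintype.card_fin, nsmul_eq_mul,
    ENNReal.ofReal_mul (by positivity), ENNReal.ofReal_natCast]

/-! ### Comparison of the test statistics with exponential spacings -/

section TestStat

variable {Ω : Type*} [MeasurableSpace Ω] {P : Measure Ω} [IsProbabilityMeasure P]
  {n p : ℕ} {X : Matrix (Fin n) (Fin p) ℝ} {β : Fin p → ℝ} {σ : ℝ} {y : Ω → Fin n → ℝ}

/-- The spacings of the transformed null scores. -/
def nullSpacing (X : Matrix (Fin n) (Fin p) ℝ) (β : Fin p → ℝ) (σ : ℝ) (y : Ω → Fin n → ℝ)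
    (ω : Ω) (k : ℕ) : ℝ :=
  spacing (fun j : {j // j ∉ support β} => cumHazard |standardScore X β σ y j ω|) k

/-- The order statistics of the absolute null scores. -/
def nullOrderStat (X : Matrix (Fin n) (Fin p) ℝ) (β : Fin p → ℝ) (σ : ℝ) (y : Ω → Fin n → ℝ)
    (ω : Ω) (k : ℕ) : ℝ :=
  orderStat (fun j : {j // j ∉ support β} => |standardScore X β σ y j ω|) k

lemma ae_injective_and_pos_score (hσ : 0 < σ) (hX : Xᵀ * X = 1)
    (hy : IsGaussianLinearModel P X β σ y) :
    ∀ᵐ ω ∂P, (Function.Injective fun j => |(Xᵀ *ᵥ y ω) j|) ∧ ∀ j, 0 < |(Xᵀ *ᵥ y ω) j| := by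
  simp_rw [score_eq (β := β) hσ]
  exact ae_injective_and_pos_affine_abs (hy.hasLaw_standardScore hσ hX)
    (hy.iIndepFun_standardScore hσ hX) hσ β

lemma aemeasurable_testStat (hσ : 0 < σ) (hX : Xᵀ * X = 1)
    (hy : IsGaussianLinearModel P X β σ y) (k : ℕ) :
    AEMeasurable (fun ω => testStat X σ (y ω) (k + 1)) P := by
  have hU : AEMeasurable (fun ω j => |(Xᵀ *ᵥ y ω) j|) P := by
    refine aemeasurable_pi_lambda _ fun j => ?_
    simp_rw [score_eq (β := β) hσ]
    have := (hy.hasLaw_standardScore hσ hX j).aemeasurable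
    fun_prop
  have hos : ∀ k, AEMeasurable (fun ω => orderStat (fun j => |(Xᵀ *ᵥ y ω) j|) k) P := fun k =>
    (measurable_orderStat k).comp_aemeasurable hU
  refine ((((hos k).mul ((hos k).sub (hos (k + 1)))).div_const (σ ^ 2))).congr ?_
  filter_upwards [ae_injective_and_pos_score hσ hX hy] with ω hω
  exact (testStat_succ_eq X hX σ (y ω) hω.2 hω.1 k).symm

omit [MeasurableSpace Ω] in
lemma orderStat_abs_score_eq (hσ : 0 < σ) {ω : Ω}
    (hinj : Function.Injective fun j => |(Xᵀ *ᵥ y ω) j|) (hsep : ω ∈ separatedEvent X β y) {k : ℕ}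
    (hk : k < Fintype.card {j // j ∉ support β}) :
    orderStat (fun j => |(Xᵀ *ᵥ y ω) j|) ((support β).card + k) =
      σ * nullOrderStat X β σ y ω k := by
  have hU : ∀ j : {j // j ∉ support β},
      |(Xᵀ *ᵥ y ω) j| = σ * |standardScore X β σ y j ω| := by
    intro j
    rw [score_eq (β := β) hσ, eq_zero_of_notMem_support j.2, zero_add, abs_mul, abs_of_pos hσ]
  rw [orderStat_card_add hinj (support β)
    fun i hi j hj => abs_score_lt_of_mem_separatedEvent hsep hi hj]
  have hinj' : Function.Injective fun j : {j // j ∉ support β} => |standardScore X β σ y j ω| := by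
    intro i j hij
    refine Subtype.val_injective (hinj ?_)
    dsimp only at hij ⊢
    rw [hU, hU, hij]
  simp_rw [hU]
  exact orderStat_comp hinj' (f := fun t => σ * t)
    (fun i j => (mul_lt_mul_iff_right₀ hσ).symm) hk

omit [MeasurableSpace Ω] in
-- The deterministic heart of the comparison: under separation the statistic is `a (a - b)` for
-- adjacent null order statistics, the factors `σ` cancelling, while the transformed spacing is
-- `cumHazard a - cumHazard b`.
lemma abs_testStat_sub_nullSpacing_le (hσ : 0 < σ) (hX : Xᵀ * X = 1) {ω : Ω}
    (hinj : Function.Injective fun j => |(Xᵀ *ᵥ y ω) j|) (h0 : ∀ j, 0 < |(Xᵀ *ᵥ y ω) j|)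
    (hsep : ω ∈ separatedEvent X β y) {k r : ℕ} (hkr : k < r)
    (hr : r < Fintype.card {j // j ∉ support β}) {B K : ℝ} (hB : 0 < B)
    (hBr : B < nullOrderStat X β σ y ω r) (hK : nullSpacing X β σ y ω k ≤ K) :
    |testStat X σ (y ω) ((support β).card + k + 1) - nullSpacing X β σ y ω k| ≤
      (K ^ 2 + K) / B ^ 2 := by
  set V : {j // j ∉ support β} → ℝ := fun j => |standardScore X β σ y j ω| with hV
  have hU : ∀ j : {j // j ∉ support β}, |(Xᵀ *ᵥ y ω) j| = σ * V j := by
    intro j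
    rw [score_eq (β := β) hσ, eq_zero_of_notMem_support j.2, zero_add, abs_mul, abs_of_pos hσ]
  have hVinj : Function.Injective V := by
    intro i j hij
    refine Subtype.val_injective (hinj ?_)
    dsimp only
    rw [hU, hU, hij]
  have hV0 : ∀ j, 0 < V j := fun j => by
    have := h0 j
    rw [hU] at this
    exact pos_of_mul_pos_right this hσ.le
  set a := orderStat V k with ha
  set b := orderStat V (k + 1) with hb
  have hba : b ≤ a := orderStat_succ_le hVinj hV0 k
  have hanti : Antitone (orderStat V) := antitone_nat_of_succ_le (orderStat_succ_le hVinj hV0)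
  -- Order statistics decrease and `k + 1 ≤ r`, so one lower bound at rank `r` serves all `k < r`.
  have hBb : B < b := hBr.trans_le (hanti (Nat.succ_le_of_lt hkr))
  have hb0 : 0 < b := hB.trans hBb
  have hT : testStat X σ (y ω) ((support β).card + k + 1) = a * (a - b) := by
    rw [testStat_succ_eq X hX σ (y ω) h0 hinj, add_assoc,
      orderStat_abs_score_eq hσ hinj hsep (hkr.trans hr),
      orderStat_abs_score_eq hσ hinj hsep (lt_of_le_of_lt (Nat.succ_le_of_lt hkr) hr)]
    change σ * a * (σ * a - σ * b) / σ ^ 2 = _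
    field_simp
  have hmono : ∀ i j, V i < V j ↔ cumHazard (V i) < cumHazard (V j) := fun i j =>
    (strictMonoOn_cumHazard.lt_iff_lt (hV0 i).le (hV0 j).le).symm
  have hD : nullSpacing X β σ y ω k = cumHazard a - cumHazard b := by
    rw [nullSpacing, spacing]
    exact congrArg₂ _ (orderStat_comp hVinj hmono (hkr.trans hr))
      (orderStat_comp hVinj hmono (lt_of_le_of_lt (Nat.succ_le_of_lt hkr) hr))
  rw [hT, hD]
  rw [hD] at hK
  have hD0 : 0 ≤ cumHazard a - cumHazard b :=
    sub_nonneg.2 (strictMonoOn_cumHazard.monotoneOn hb0.le (hb0.le.trans hba) hba)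
  have hK0 : 0 ≤ K := hD0.trans hK
  exact (abs_mul_sub_sub_cumHazard_le hb0 hba).trans (by gcongr)

lemma hasLaw_nullSpacing (hσ : 0 < σ) (hX : Xᵀ * X = 1)
    (hy : IsGaussianLinearModel P X β σ y) {r : ℕ}
    (hr : r ≤ Fintype.card {j // j ∉ support β}) :
    HasLaw (fun ω (i : Fin r) => nullSpacing X β σ y ω i) (expLaw r) P :=
  hasLaw_spacing_cumHazard (Z := fun j : {j // j ∉ support β} => standardScore X β σ y j)
    (fun j => hy.hasLaw_standardScore hσ hX j)
    ((hy.iIndepFun_standardScore hσ hX).precomp Subtype.val_injective) hr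

lemma measure_nullOrderStat_le (hσ : 0 < σ) (hX : Xᵀ * X = 1)
    (hy : IsGaussianLinearModel P X β σ y) {r : ℕ}
    (hr : r < Fintype.card {j // j ∉ support β}) (B : ℝ) :
    P {ω | nullOrderStat X β σ y ω r ≤ B} ≤
      (Fintype.card {j // j ∉ support β} : ENNReal) ^ r *
        ENNReal.ofReal (1 - normalTail B) ^ (Fintype.card {j // j ∉ support β} - r) :=
  measure_orderStat_abs_le (Z := fun j : {j // j ∉ support β} => standardScore X β σ y j)
    (fun j => hy.hasLaw_standardScore hσ hX j)
    ((hy.iIndepFun_standardScore hσ hX).precomp Subtype.val_injective) hr B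

/-- Outside three bad events (no separation, a spacing above `K`, a null order statistic of index
`r` at most `B`) the deterministic bound holds in every coordinate, hence in the sup norm. -/
lemma measure_le_norm_testStat_sub_le (hσ : 0 < σ) (hX : Xᵀ * X = 1)
    (hy : IsGaussianLinearModel P X β σ y) {r : ℕ}
    (hr : r < Fintype.card {j // j ∉ support β}) {ε B K : ℝ} (hε : 0 < ε) (hB : 0 < B)
    (hK : 0 ≤ K) (hBK : (K ^ 2 + K) / B ^ 2 < ε) :
    P {ω | ε ≤ ‖(fun i : Fin r => testStat X σ (y ω) ((support β).card + (i : ℕ) + 1)) -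
        fun i : Fin r => nullSpacing X β σ y ω i‖} ≤
      P (separatedEvent X β y)ᶜ + ENNReal.ofReal (r * Real.exp (-K)) +
        P {ω | nullOrderStat X β σ y ω r ≤ B} := by
  have hlaw := hasLaw_nullSpacing hσ hX hy hr.le
  have hDm : MeasurableSet {x : Fin r → ℝ | ∃ i, K < x i} := by
    simp only [Set.ofPred_exists]
    exact MeasurableSet.iUnion fun i => measurableSet_lt measurable_const (measurable_pi_apply i)
  have hD : P {ω | ∃ i : Fin r, K < nullSpacing X β σ y ω i} ≤
      ENNReal.ofReal (r * Real.exp (-K)) := by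
    rw [hlaw.measure_eq (p := fun x => ∃ i, K < x i) hDm]
    exact expLaw_exists_lt_le hK
  have hsub : ({ω | ε ≤ ‖(fun i : Fin r => testStat X σ (y ω) ((support β).card + (i : ℕ) + 1)) -
        fun i : Fin r => nullSpacing X β σ y ω i‖} : Set Ω) ≤ᵐ[P]
      ((separatedEvent X β y)ᶜ ∪ {ω | ∃ i : Fin r, K < nullSpacing X β σ y ω i} ∪
        {ω | nullOrderStat X β σ y ω r ≤ B} : Set Ω) := by
    filter_upwards [ae_injective_and_pos_score hσ hX hy] with ω hω hle
    by_contra hnot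
    replace hnot : ω ∉ ((separatedEvent X β y)ᶜ ∪
      {ω | ∃ i : Fin r, K < nullSpacing X β σ y ω i} ∪
        {ω | nullOrderStat X β σ y ω r ≤ B} : Set Ω) := hnot
    simp only [Set.mem_union, Set.mem_compl_iff, Set.mem_ofPred_eq, not_or, not_not, not_exists,
      not_lt, not_le] at hnot
    obtain ⟨⟨hsep, hsp⟩, hB'⟩ := hnot
    refine absurd hle (not_le.2 ((pi_norm_lt_iff hε).2 fun i => ?_))
    exact (abs_testStat_sub_nullSpacing_le hσ hX hω.1 hω.2 hsep i.2 hr hB hB' (hsp i)).trans_lt hBK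
  refine (measure_mono_ae hsub).trans ((measure_union_le _ _).trans ?_)
  gcongr
  exact (measure_union_le _ _).trans (by gcongr)

end TestStat

end LassoTest

end

/-! ### The limit theorem -/

theorem proposition1
    {Ω : ℕ → Type*} [∀ p, MeasurableSpace (Ω p)]
    (P : (p : ℕ) → Measure (Ω p)) [∀ p, IsProbabilityMeasure (P p)]
    (n : ℕ → ℕ) (X : (p : ℕ) → Matrix (Fin (n p)) (Fin p) ℝ)
    (hX : ∀ p, (X p)ᵀ * X p = 1)
    (β : (p : ℕ) → Fin p → ℝ) (σ : ℝ) (hσ : 0 < σ)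
    (y : (p : ℕ) → Ω p → Fin (n p) → ℝ)
    (hy : ∀ p, LassoTest.IsGaussianLinearModel (P p) (X p) (β p) σ (y p))
    (kstar : ℕ) (hk : ∀ᶠ p in atTop, (LassoTest.support (β p)).card = kstar)
    (hβ : Tendsto
      (fun p : ℕ => (⨅ j ∈ LassoTest.support (β p), ((|β p j| : ℝ) : EReal))
        - ((σ * Real.sqrt (2 * Real.log p) : ℝ) : EReal)) atTop (𝓝 ⊤)) :
    Tendsto
      (fun p => P p {ω |
        (⨆ j ∉ LassoTest.support (β p), ((|((X p)ᵀ *ᵥ y p ω) j| : ℝ) : EReal))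
          < ⨅ j ∈ LassoTest.support (β p), ((|((X p)ᵀ *ᵥ y p ω) j| : ℝ) : EReal)})
      atTop (𝓝 1) ∧
    ∀ r : ℕ,
      TendstoInDistribution
        (fun (p : ℕ) (ω : Ω p) (i : Fin r) =>
          LassoTest.testStat (X p) σ (y p ω) (kstar + (i : ℕ) + 1))
        atTop (id : (Fin r → ℝ) → (Fin r → ℝ)) P (LassoTest.expLaw r) := by
  have hsep := LassoTest.tendsto_measure_compl_separatedEvent hX hσ hy hk hβ
  refine ⟨LassoTest.tendsto_measure_one_of_compl hsep, fun r => ?_⟩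
  have hcard : ∀ᶠ p in atTop,
      Fintype.card {j // j ∉ LassoTest.support (β p)} = p - kstar := by
    filter_upwards [hk] with p hp
    rw [Fintype.card_subtype_compl, Fintype.card_coe, hp, Fintype.card_fin]
  refine LassoTest.tendstoInDistribution_of_hasLaw
    (D := fun p ω (i : Fin r) => LassoTest.nullSpacing (X p) (β p) σ (y p) ω i)
    (fun p => aemeasurable_pi_lambda _ fun i =>
      LassoTest.aemeasurable_testStat hσ (hX p) (hy p) _) ?_ fun ε hε => ?_
  -- The spacings have the limit law exactly once at least `r` null variables exist.
  · filter_upwards [hcard, eventually_ge_atTop (kstar + r)] with p hp hpr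
    exact LassoTest.hasLaw_nullSpacing hσ (hX p) (hy p) (by omega)
  rw [ENNReal.tendsto_nhds_zero]
  intro δ hδ
  have hδ3 : 0 < δ / 3 := ENNReal.div_pos hδ.ne' (by norm_num)
  have hexp : Tendsto (fun K : ℝ => ENNReal.ofReal (r * Real.exp (-K))) atTop (𝓝 0) := by
    have h := ENNReal.tendsto_ofReal
      ((Real.tendsto_exp_atBot.comp tendsto_neg_atTop_atBot).const_mul (r : ℝ))
    simpa using h
  -- Order of choices: `K` makes large spacings unlikely, then `B` makes the deterministic error
  -- smaller than `ε`, and only then does `p` grow, so that the order statistic exceeds `B` with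
  -- high probability.
  obtain ⟨K, hKδ, hK⟩ :=
    (((ENNReal.tendsto_nhds_zero.1 hexp) (δ / 3) hδ3).and (eventually_ge_atTop 0)).exists
  have hBlim : Tendsto (fun B : ℝ => (K ^ 2 + K) / B ^ 2) atTop (𝓝 0) :=
    tendsto_const_nhds.div_atTop (tendsto_pow_atTop two_ne_zero)
  obtain ⟨B, hBK, hB⟩ := ((hBlim.eventually (gt_mem_nhds hε)).and (eventually_gt_atTop 0)).exists
  have hq : ENNReal.ofReal (1 - LassoTest.normalTail B) < 1 := by
    rw [← ENNReal.ofReal_one]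
    exact (ENNReal.ofReal_lt_ofReal_iff one_pos).2
      (by linarith [LassoTest.normalTail_pos hB.le])
  have hq0 : ENNReal.ofReal (1 - LassoTest.normalTail B) ≠ 0 := by
    rw [Ne, ENNReal.ofReal_eq_zero, not_le, sub_pos]
    refine (LassoTest.normalTail_le hB.le).trans_lt (Real.exp_lt_one_iff.2 ?_)
    nlinarith
  have hos := (LassoTest.tendsto_pow_mul_pow_sub hq hq0 r).comp (tendsto_sub_atTop_nat kstar)
  filter_upwards [hk, hcard, eventually_gt_atTop (kstar + r),
    (ENNReal.tendsto_nhds_zero.1 hsep) (δ / 3) hδ3,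
    (ENNReal.tendsto_nhds_zero.1 hos) (δ / 3) hδ3] with p hkp hcp hpr h1 h2
  have hr : r < Fintype.card {j // j ∉ LassoTest.support (β p)} := by omega
  have h3 := LassoTest.measure_le_norm_testStat_sub_le hσ (hX p) (hy p) hr hε hB hK hBK
  have h4 := LassoTest.measure_nullOrderStat_le hσ (hX p) (hy p) hr B
  rw [hcp] at h4
  rw [hkp] at h3
  calc _ ≤ _ := h3
    _ ≤ δ / 3 + δ / 3 + δ / 3 := add_le_add (add_le_add h1 hKδ) (h4.trans h2)
    _ = δ := ENNReal.add_thirds δ
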